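/- **Setting.** Let $\Omega$ be a finite linearly ordered set of $n$ elements, partitioned into $k$ groups $g_1,\dots,g_k$ (some may be empty), and let $f:2^\Omega\to\mathbb R_{\ge 0}$ be submodular (not necessarily monotone) with $f(\emptyset)=0$. Put $f_S(A)=f(S\cup A)-f(S)$. A set is independent if it contains at most one element of each group. "Higher under $f_S$" compares the values $f_S(\{e\})$; ties are broken by the fixed linear order of $\Omega$. **Arrivals.** The elements arrive in uniformly random order. Independently of the order, $(N_0,N_1,\dots,N_k,N_{k+1})$ is multinomial with $n$ trials and cell probabilities $\frac12,\frac1{100k},\dots,\frac1{100k},\frac12-\frac1{100}$, so that $N_0\sim B(n,\frac12)$ and $N_j\sim B(n,\frac1{100k})$ for $1\le j\le k$. The first $N_0$ elements are a sample, the next $N_1$ elements are epoch $1$, the next $N_2$ are epoch $2$, and so on; the last $N_{k+1}$ elements are ignored. **Algorithm.** Choose a mode $A$, $B$ or $C$ uniformly at random, and let $S_0=\emptyset$. In epoch $j=1,\dots,k$, consider the first arriving element $x$ of the epoch such that $S_{j-1}$ contains no element of the group of $x$, and $x$ is higher under $f_{S_{j-1}}$ than every element of its group that arrived before epoch $j$.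 If there is such an $x$ (the *candidate*, or the element *selected*, of epoch $j$), flip a fair coin: in modes $A$ and $B$ set $S_j=S_{j-1}\cup\{x\}$ on heads and $S_j=S_{j-1}$ on tails; in mode $C$ do the reverse. If there is no such $x$, set $S_j=S_{j-1}$. Return $S_k$ in modes $A$ and $C$; in mode $B$ return a random subset of $S_k$ that keeps each element independently with probability $\frac12$. **Statement.** 1. Let $1\le j\le k$ and let $g_i$ be a non-empty group. For epoch $j$ and the valuation $f_{S_{j-1}}$, let $H_{i,j}$ be the event that the highest element of $g_i$ falls into epoch $j$; let $\Sigma_{i,j}$ be the event that the second highest element of $g_i$ (if any) arrives before epoch $j$; let $F_{i,j}$ be the event that the highest element of $g_i$ among those seen until the end of epoch $j$ falls into epoch $j$; and let $P_{i,j}$ be the event $S_{j-1}\cap g_i\ne\emptyset$. Then, for every mode and every fixed outcome of the $k$ coins, with probability over the arrival order and the epoch lengths, $$\Pr\Big[H_{i,j}\wedge \Sigma_{i,j}\wedge\neg P_{i,j}\wedge\bigwedge_{i'\neq i}\neg F_{i',j}\Big]\ \ge\ \frac{37}{16000\,k},$$ $$\Pr\big[\text{the candidate of epoch } j \text{ is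 the highest element of } g_i \text{ under } f_{S_{j-1}}\big]\ \ge\ \frac{37}{16000\,k}.$$ Consequently, over all the randomness (including the mode and the coins), the highest element of $g_i$ under $f_{S_{j-1}}$ belongs to $S_j\setminus S_{j-1}$ with probability at least $\frac{37}{32000\,k}$. 2. The set returned by the algorithm is always independent, and there is an absolute constant $C>0$ such that, for all $k$, $\Omega$, $g$, $f$ as above, the expected value of $f$ at the returned set is at least $\frac1C\max\{f(T): T\subseteq\Omega\text{ independent}\}$. -/

import Mathlib

open Finset

universe u

namespace SubmodularSecretary

/-! Submodular functions and partition matroids. -/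

section Basic

variable {Ω : Type u} [DecidableEq Ω]

/-- `f(S) + f(T) ≥ f(S ∪ T) + f(S ∩ T)` for all `S, T`. -/
def IsSubmodular (f : Finset Ω → ℝ) : Prop :=
  ∀ S T : Finset Ω, f (S ∪ T) + f (S ∩ T) ≤ f S + f T

/-- The marginal value `f_S(A) = f(S ∪ A) - f(S)`. -/
def marginal (f : Finset Ω → ℝ) (S A : Finset Ω) : ℝ := f (S ∪ A) - f S

/-- Independence in the partition matroid whose groups are the fibres of `g`:
at most one element from each group. -/
def PartitionIndep {k : ℕ} (g : Ω → Fin k) (S : Finset Ω) : Prop :=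
  ∀ i : Fin k, (S.filter (fun e => g e = i)).card ≤ 1

end Basic

section Valuation

variable {Ω : Type u} [LinearOrder Ω]

/-- `a` is strictly lower than `b` under the valuation function `f_S`; ties in value are broken
by the fixed linear order on the universe. -/
def Lower (f : Finset Ω → ℝ) (S : Finset Ω) (a b : Ω) : Prop :=
  marginal f S {a} < marginal f S {b} ∨ (marginal f S {a} = marginal f S {b} ∧ a < b)

/-- `e` is the highest element of `A` under the valuation function `f_S`. -/
def IsHighest (f : Finset Ω → ℝ) (S A : Finset Ω) (e : Ω) : Prop :=
  e ∈ A ∧ ∀ e' ∈ A, e' ≠ e → Lower f S e' e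

end Valuation

/-! The random arrival order and the random epoch lengths. -/

section Arrival

variable (Ω : Type u) [Fintype Ω] (k : ℕ)

/-- What the arrivals depend on: an order of the universe (the element in position `t` is the
value at `t`), and a label in `{0, …, k + 1}` for each of the `n` positions. Only the *numbers*
`N_j` of occurrences of the labels are used: the first `N_0` elements are the initial sample, the
next `N_1` are epoch 1, then `N_2` elements are epoch 2, …; the last `N_{k+1}` elements are
ignored. -/
abbrev Arrival : Type u :=
  (Fin (Fintype.card Ω) ≃ Ω) × (Fin (Fintype.card Ω) → Fin (k + 2))

/-- The probability of a label: `1/2` for the sample, `1/(100k)` for each of the epochs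
`1, …, k`, and the rest for the elements that are ignored. -/
noncomputable def labelProb (j : Fin (k + 2)) : ℝ :=
  if (j : ℕ) = 0 then 1 / 2
  else if (j : ℕ) ≤ k then 1 / (100 * (k : ℝ))
  else 1 - 1 / 2 - (k : ℝ) * (1 / (100 * (k : ℝ)))

variable {Ω k}

/-- The arrival order is uniformly random and, independently of it, the labels are independent
with law `labelProb`. So `N_0 ∼ B(n, 1/2)`, `N_j ∼ B(n, 1/(100k))` for `1 ≤ j ≤ k`, and the
vector `(N_0, …, N_{k+1})` is multinomial. -/
noncomputable def arrivalWeight (ω : Arrival Ω k) : ℝ :=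
  1 / ((Fintype.card Ω).factorial : ℝ) * ∏ t, labelProb k (ω.2 t)

open scoped Classical in
/-- The probability of an event that concerns the arrival order and the epoch lengths. -/
noncomputable def arrivalProb [DecidableEq Ω] (E : Arrival Ω k → Prop) : ℝ :=
  ∑ ω : Arrival Ω k, if E ω then arrivalWeight ω else 0

theorem sum_labelProb (k : ℕ) : ∑ j, labelProb k j = 1 := by
  rw [Fin.sum_univ_succ, Fin.sum_univ_castSucc]
  simp [labelProb]

theorem labelProb_nonneg (k : ℕ) (j : Fin (k + 2)) : 0 ≤ labelProb k j := by
  unfold labelProb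
  split_ifs
  · norm_num
  · positivity
  · rcases Nat.eq_zero_or_pos k with rfl | hk
    · norm_num
    · have : (k : ℝ) ≠ 0 := by positivity
      field_simp
      norm_num

theorem sum_arrivalWeight [DecidableEq Ω] : ∑ ω : Arrival Ω k, arrivalWeight ω = 1 := by
  have h : ∑ l : Fin (Fintype.card Ω) → Fin (k + 2), ∏ t, labelProb k (l t) = 1 := by
    have := (Fintype.prod_sum (fun (_ : Fin (Fintype.card Ω)) j => labelProb k j)).symm
    rw [this]
    simp [sum_labelProb]
  have hc : Fintype.card (Fin (Fintype.card Ω) ≃ Ω) = (Fintype.card Ω).factorial := by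
    rw [Fintype.card_equiv (Fintype.equivFin Ω).symm, Fintype.card_fin]
  have h0 : ((Fintype.card Ω).factorial : ℝ) ≠ 0 := by positivity
  rw [Fintype.sum_prod_type]
  simp only [arrivalWeight, ← mul_sum, h]
  simp [hc, h0]

/-- The length `N_j` of block `j` (block `0` is the sample, block `j` is epoch `j`). -/
def blockLength (ω : Arrival Ω k) (j : ℕ) : ℕ :=
  (univ.filter (fun t => (ω.2 t : ℕ) = j)).card

/-- The number `N_0 + ⋯ + N_{j-1}` of elements that arrive before block `j`. -/
def blockStart (ω : Arrival Ω k) (j : ℕ) : ℕ := ∑ i ∈ range j, blockLength ω i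

/-- The elements that arrive before block `j`. -/
def arrivedBefore (ω : Arrival Ω k) (j : ℕ) : Finset Ω :=
  univ.filter (fun e => (ω.1.symm e : ℕ) < blockStart ω j)

/-- The elements that arrive in block `j`. -/
def block (ω : Arrival Ω k) (j : ℕ) : Finset Ω :=
  univ.filter (fun e => blockStart ω j ≤ (ω.1.symm e : ℕ) ∧
    (ω.1.symm e : ℕ) < blockStart ω (j + 1))

end Arrival

/-! The algorithm. -/

/-- The three modes of the algorithm. -/
inductive Mode
  | A
  | B
  | C
  deriving DecidableEq

instance : Fintype Mode := ⟨{Mode.A, Mode.B, Mode.C}, fun m => by cases m <;> simp⟩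

/-- Does the algorithm keep the element when the coin shows heads (`true`) or tails (`false`)?
On heads in modes `A` and `B`, on tails in mode `C`. -/
def Mode.accepts : Mode → Bool → Bool
  | Mode.A, coin => coin
  | Mode.B, coin => coin
  | Mode.C, coin => !coin

section Algorithm

variable {Ω : Type u} [Fintype Ω] [LinearOrder Ω] {k : ℕ}

/-- With `S` the set selected before epoch `j`, the element `e` qualifies in epoch `j`: it arrives
in epoch `j`, nothing from its group has been selected yet, and under `f_S` it is higher than every
element of its group that arrived before epoch `j`. -/
def Qualifies (g : Ω → Fin k) (f : Finset Ω → ℝ) (ω : Arrival Ω k) (S : Finset Ω) (j : ℕ)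
    (e : Ω) : Prop :=
  e ∈ block ω j ∧ (∀ s ∈ S, g s ≠ g e) ∧ ∀ e' ∈ arrivedBefore ω j, g e' = g e → Lower f S e' e

open scoped Classical in
/-- The element for which the coin is flipped in epoch `j`: the first one, in order of arrival,
that qualifies. -/
noncomputable def candidate (g : Ω → Fin k) (f : Finset Ω → ℝ) (ω : Arrival Ω k) (S : Finset Ω)
    (j : ℕ) : Option Ω :=
  (List.ofFn ω.1).find? (fun e => decide (Qualifies g f ω S j e))

/-- The set `S_j` selected by the end of epoch `j`, in mode `m`, where `c` lists the coins of the
epochs `1, …, k`. -/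
noncomputable def selected (g : Ω → Fin k) (f : Finset Ω → ℝ) (ω : Arrival Ω k) (m : Mode)
    (c : Fin k → Bool) : ℕ → Finset Ω
  | 0 => ∅
  | j + 1 =>
    let S := selected g f ω m c j
    if h : j < k then
      match candidate g f ω S (j + 1) with
      | none => S
      | some x => if m.accepts (c ⟨j, h⟩) then insert x S else S
    else S

variable (Ω k) in
/-- All the randomness: arrivals, mode, one coin per epoch, and for each element whether
it would survive the final discarding step of mode `B`. -/
abbrev Outcome : Type u := Arrival Ω k × Mode × (Fin k → Bool) × (Ω → Bool)

/-- The returned set: `S_k`, thinned out in mode `B`. -/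
noncomputable def output (g : Ω → Fin k) (f : Finset Ω → ℝ) (o : Outcome Ω k) : Finset Ω :=
  match o with
  | (ω, m, c, keep) =>
    match m with
    | Mode.B => (selected g f ω m c k).filter (fun e => keep e = true)
    | _ => selected g f ω m c k

/-- The arrivals, the mode, the coins and the discarding step are independent; the mode is uniform
and all the coins are fair. -/
noncomputable def outcomeWeight (o : Outcome Ω k) : ℝ :=
  arrivalWeight o.1 * (1 / 3) * (1 / 2) ^ k * (1 / 2) ^ Fintype.card Ω

theorem sum_outcomeWeight : ∑ o : Outcome Ω k, outcomeWeight o = 1 := by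
  have h3 : Fintype.card Mode = 3 := rfl
  simp only [outcomeWeight, Fintype.sum_prod_type, sum_const, card_univ, nsmul_eq_mul,
    Fintype.card_prod, Fintype.card_fun, Fintype.card_bool, Fintype.card_fin, h3]
  have h := sum_arrivalWeight (Ω := Ω) (k := k)
  rw [Fintype.sum_prod_type] at h
  refine Eq.trans ?_ h
  refine sum_congr rfl fun a _ => sum_congr rfl fun b _ => ?_
  push_cast
  have e1 : (2 : ℝ) ^ k * (1 / 2) ^ k = 1 := by rw [← mul_pow]; norm_num
  have e2 : (2 : ℝ) ^ Fintype.card Ω * (1 / 2) ^ Fintype.card Ω = 1 := by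
    rw [← mul_pow]; norm_num
  linear_combination
    arrivalWeight (a, b) * (2 : ℝ) ^ Fintype.card Ω * (1 / 2) ^ Fintype.card Ω * e1 +
      arrivalWeight (a, b) * e2

/-- Expectation over all the randomness. -/
noncomputable def expectation (X : Outcome Ω k → ℝ) : ℝ := ∑ o : Outcome Ω k, outcomeWeight o * X o

open scoped Classical in
/-- Probability over all the randomness. -/
noncomputable def prob (E : Outcome Ω k → Prop) : ℝ :=
  ∑ o : Outcome Ω k, if E o then outcomeWeight o else 0

/-! The events in the analysis of epoch `j`; here `S` is the set selected before epoch `j`, so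
that `f_S` is the valuation function used during epoch `j`. -/

/-- The elements of group `i`. -/
def groupSet (g : Ω → Fin k) (i : Fin k) : Finset Ω := univ.filter (fun e => g e = i)

/-- The highest element of group `i` falls into epoch `j`. -/
def EventH (g : Ω → Fin k) (f : Finset Ω → ℝ) (ω : Arrival Ω k) (S : Finset Ω) (i : Fin k)
    (j : ℕ) : Prop :=
  ∃ e, IsHighest f S (groupSet g i) e ∧ e ∈ block ω j

/-- The second highest element of group `i`, if any, falls before epoch `j`. -/
def EventS (g : Ω → Fin k) (f : Finset Ω → ℝ) (ω : Arrival Ω k) (S : Finset Ω) (i : Fin k)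
    (j : ℕ) : Prop :=
  ∀ e e', IsHighest f S (groupSet g i) e → IsHighest f S ((groupSet g i).erase e) e' →
    e' ∈ arrivedBefore ω j

/-- The highest among the elements of group `i` that are seen until the end of epoch `j` falls into
epoch `j`. -/
def EventF (g : Ω → Fin k) (f : Finset Ω → ℝ) (ω : Arrival Ω k) (S : Finset Ω) (i : Fin k)
    (j : ℕ) : Prop :=
  ∃ e, IsHighest f S (groupSet g i ∩ arrivedBefore ω (j + 1)) e ∧ e ∈ block ω j

/-- Some element of group `i` is already in `S`. -/
def EventP (g : Ω → Fin k) (S : Finset Ω) (i : Fin k) : Prop := ∃ e ∈ S, g e = i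

/-- `H ∧ S ∧ ¬P` for group `i` and `¬F` for all the other groups. -/
def GoodEvent (g : Ω → Fin k) (f : Finset Ω → ℝ) (ω : Arrival Ω k) (S : Finset Ω) (i : Fin k)
    (j : ℕ) : Prop :=
  (EventH g f ω S i j ∧ EventS g f ω S i j ∧ ¬ EventP g S i) ∧
    ∀ i' : Fin k, i' ≠ i → ¬ EventF g f ω S i' j

end Algorithm

end SubmodularSecretary

open SubmodularSecretary

set_option linter.unusedSectionVars false

namespace SubmodularSecretary

/-! Sampling lengths and then cutting a random order into blocks is the same as giving every element
an independent label (sample, epoch, ignored) and a uniformly random order `σ` within blocks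
(`arrivalMean_eq_sum_labelMean`). So it suffices to work with independent labels for each fixed `σ`.
An element is `50k` times as likely to be in the sample as in a given epoch; moving elements from an
epoch to the sample is the source of all upper bounds.

Part 1. The set selected before an epoch depends on the labels of group `i`, so the run is compared
with one that ignores group `i`, whose sets are independent of those labels. For the ignoring run,
"highest of the group in this epoch, second highest in the sample" has probability `β / (100k)` with
`β ≥ 1/2`, independently of the other groups (`labelMean_topEvent_mul`). Two things can spoil this.
Group `i` may interfere in an earlier epoch; this needs its highest element so far to be in that
epoch, which costs `1/(50k)` per epoch (`labelMean_labelEventF_mul_le`). Or another group has its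
highest element so far in the current epoch. The valuation then depends on that group too, but only
through an earlier selected element of it, after which the group can be ignored; such coincidences
cost `2/(50k)^2` per earlier epoch (`labelMean_labelEventF_pair_le`). Both losses are small
fractions of the main term. The estimate `le_labelMean_mul_goodEvent` carries a weight `Y` depending
on the current set: `Y = 1` gives part 1, and group shares give part 2.

Part 2. Let `T` be optimal. The value `f(S ∪ T) - f(S)` is bounded by a sum of shares, one per
group, each at most the truncated marginal of the highest element of the group. The weighted
estimate therefore bounds the expected truncated marginal of each candidate below. Turning over all
coins yields a disjoint selected set, so by submodularity `f(S ∪ T)` averages at least `f(T)/2`. If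
the expected total gain `D` is small, then `f(S)` is small too and every epoch gains `Ω(f(T)/k)`;
hence `D` is a constant fraction of `f(T)`. Some subset of the final set attains the total gain, and
a random half of the final set, as in mode `B`, is worth a quarter of any subset. The other modes
contribute nonnegative value. -/

open scoped Classical in
/-- The indicator of a proposition. -/
noncomputable def ind (P : Prop) : ℝ := if P then 1 else 0

theorem ind_of {P : Prop} (h : P) : ind P = 1 := by simp [ind, h]

theorem ind_of_not {P : Prop} (h : ¬ P) : ind P = 0 := by simp [ind, h]

theorem ind_nonneg (P : Prop) : 0 ≤ ind P := by unfold ind; split_ifs <;> norm_num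

theorem ind_le_one (P : Prop) : ind P ≤ 1 := by unfold ind; split_ifs <;> norm_num

theorem ind_mono {P Q : Prop} (h : P → Q) : ind P ≤ ind Q := by
  by_cases hP : P
  · rw [ind_of hP, ind_of (h hP)]
  · rw [ind_of_not hP]; exact ind_nonneg Q

theorem ind_congr {P Q : Prop} (h : P ↔ Q) : ind P = ind Q := by rw [propext h]

theorem ind_and (P Q : Prop) : ind (P ∧ Q) = ind P * ind Q := by
  by_cases hP : P <;> by_cases hQ : Q <;> simp [ind, hP, hQ]

/-- Union bound for an existential statement over a finite type. -/
theorem ind_exists_le_sum {ι : Type*} [Fintype ι] (P : ι → Prop) :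
    ind (∃ x, P x) ≤ ∑ x, ind (P x) := by
  by_cases h : ∃ x, P x
  · obtain ⟨x, hx⟩ := h
    rw [ind_of ⟨x, hx⟩, ← ind_of hx]
    exact single_le_sum (f := fun x => ind (P x)) (fun _ _ => ind_nonneg _) (mem_univ x)
  · rw [ind_of_not h]
    exact sum_nonneg fun _ _ => ind_nonneg _

/-- The indicators of pairwise exclusive statements add up to at most `1`. -/
theorem sum_ind_le_one {ι : Type*} [Fintype ι] (P : ι → Prop)
    (h : ∀ x y, P x → P y → x = y) : ∑ x, ind (P x) ≤ 1 := by
  classical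
  by_cases hP : ∃ x, P x
  · obtain ⟨x, hx⟩ := hP
    rw [sum_eq_single x (fun y _ hy => ind_of_not fun hPy => hy (h y x hPy hx)) (by simp)]
    exact ind_le_one _
  · push Not at hP
    rw [sum_eq_zero fun x _ => ind_of_not (hP x)]
    norm_num

theorem sum_ind_eq_one {ι : Type*} [Fintype ι] (x : ι) : ∑ y, ind (x = y) = 1 := by
  classical
  rw [sum_eq_single x (fun y _ hy => ind_of_not fun h => hy h.symm) (by simp), ind_of rfl]

/-! Independent labels for the elements. -/

section Labels

variable {Ω : Type u} [Fintype Ω] [DecidableEq Ω] {k : ℕ}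

/-- The probability of a labelling when the elements have independent labels. -/
noncomputable def labelWeight (l : Ω → Fin (k + 2)) : ℝ := ∏ e, labelProb k (l e)

/-- Expectation over independent labels of the elements. -/
noncomputable def labelMean (X : (Ω → Fin (k + 2)) → ℝ) : ℝ := ∑ l, labelWeight l * X l

theorem labelWeight_nonneg (l : Ω → Fin (k + 2)) : 0 ≤ labelWeight l :=
  prod_nonneg fun _ _ => labelProb_nonneg k _

theorem sum_labelWeight : ∑ l : Ω → Fin (k + 2), labelWeight l = 1 := by
  have := (Fintype.prod_sum (fun (_ : Ω) j => labelProb k j)).symm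
  simp only [labelWeight]
  rw [this]
  simp [sum_labelProb]

theorem labelMean_mono {X Y : (Ω → Fin (k + 2)) → ℝ} (h : ∀ l, X l ≤ Y l) :
    labelMean X ≤ labelMean Y :=
  sum_le_sum fun l _ => mul_le_mul_of_nonneg_left (h l) (labelWeight_nonneg l)

theorem labelMean_nonneg {X : (Ω → Fin (k + 2)) → ℝ} (h : ∀ l, 0 ≤ X l) : 0 ≤ labelMean X :=
  sum_nonneg fun l _ => mul_nonneg (labelWeight_nonneg l) (h l)

theorem labelMean_const (a : ℝ) : labelMean (fun _ : Ω → Fin (k + 2) => a) = a := by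
  rw [labelMean, ← sum_mul, sum_labelWeight, one_mul]

theorem labelMean_add (X Y : (Ω → Fin (k + 2)) → ℝ) :
    labelMean (fun l => X l + Y l) = labelMean X + labelMean Y := by
  simp only [labelMean, mul_add, sum_add_distrib]

theorem labelMean_sub (X Y : (Ω → Fin (k + 2)) → ℝ) :
    labelMean (fun l => X l - Y l) = labelMean X - labelMean Y := by
  simp only [labelMean, mul_sub, sum_sub_distrib]

theorem labelMean_const_mul (a : ℝ) (X : (Ω → Fin (k + 2)) → ℝ) :
    labelMean (fun l => a * X l) = a * labelMean X := by
  simp only [labelMean, mul_sum]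
  exact sum_congr rfl fun l _ => by ring

theorem labelMean_sum {ι : Type*} (s : Finset ι) (X : ι → (Ω → Fin (k + 2)) → ℝ) :
    labelMean (fun l => ∑ x ∈ s, X x l) = ∑ x ∈ s, labelMean (X x) := by
  simp only [labelMean, mul_sum]
  exact sum_comm

theorem labelWeight_update (l : Ω → Fin (k + 2)) (e : Ω) (b : Fin (k + 2)) :
    labelProb k (l e) * labelWeight (Function.update l e b) = labelProb k b * labelWeight l := by
  have h1 := prod_erase_mul univ (fun x => labelProb k (l x)) (mem_univ e)
  have h2 := prod_erase_mul univ (fun x => labelProb k (Function.update l e b x)) (mem_univ e)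
  have h3 : ∏ x ∈ univ.erase e, labelProb k (Function.update l e b x) =
      ∏ x ∈ univ.erase e, labelProb k (l x) :=
    prod_congr rfl fun x hx => by rw [Function.update_of_ne (ne_of_mem_erase hx)]
  simp only [labelWeight]
  rw [← h1, ← h2, h3]
  simp
  ring

/-- Changing one label changes the probability by the ratio of the label probabilities. -/
theorem labelProb_mul_labelMean_ind (e : Ω) (a b : Fin (k + 2)) (X : (Ω → Fin (k + 2)) → ℝ)
    (hX : ∀ l v, X (Function.update l e v) = X l) :
    labelProb k b * labelMean (fun l => ind (l e = a) * X l) =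
      labelProb k a * labelMean (fun l => ind (l e = b) * X l) := by
  -- Exchanging the values `a` and `b` of the label of `e` is an involution on labellings that
  -- leaves `X` fixed.
  have hinv : Function.Involutive
      (fun l : Ω → Fin (k + 2) => Function.update l e (Equiv.swap a b (l e))) := by
    intro l; simp
  simp only [labelMean, mul_sum]
  refine Fintype.sum_equiv hinv.toPerm _ _ fun l => ?_
  simp only [Function.Involutive.coe_toPerm, Function.update_self, hX]
  by_cases h : l e = a
  · have h2 := labelWeight_update l e b
    simp only [h, Equiv.swap_apply_left, ind_of] at h2 ⊢
    linear_combination X l * (-h2)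
  · rw [ind_of_not h, ind_of_not (fun h' => h ?_)]
    · ring
    · rwa [Equiv.swap_apply_eq_iff, Equiv.swap_apply_right] at h'

/-- The label of `e` is independent of everything that does not depend on it. -/
theorem labelMean_ind_mul (e : Ω) (a : Fin (k + 2)) (X : (Ω → Fin (k + 2)) → ℝ)
    (hX : ∀ l v, X (Function.update l e v) = X l) :
    labelMean (fun l => ind (l e = a) * X l) = labelProb k a * labelMean X := by
  have h : ∑ b, labelProb k b * labelMean (fun l => ind (l e = a) * X l) =
      ∑ b, labelProb k a * labelMean (fun l => ind (l e = b) * X l) :=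
    sum_congr rfl fun b _ => labelProb_mul_labelMean_ind e a b X hX
  rw [← sum_mul, sum_labelProb, one_mul] at h
  rw [h, ← mul_sum, ← labelMean_sum]
  congr 2
  ext l
  rw [← sum_mul, sum_ind_eq_one, one_mul]

/-- The same for a random element `h`, as long as its choice does not depend on its label. -/
theorem labelMean_ind_apply_mul (h : (Ω → Fin (k + 2)) → Ω) (a : Fin (k + 2))
    (X : (Ω → Fin (k + 2)) → ℝ) (hh : ∀ l v, h (Function.update l (h l) v) = h l)
    (hX : ∀ l v, X (Function.update l (h l) v) = X l) :
    labelMean (fun l => ind (l (h l) = a) * X l) = labelProb k a * labelMean X := by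
  have key : ∀ e, labelMean (fun l => ind (l e = a) * (ind (h l = e) * X l)) =
      labelProb k a * labelMean (fun l => ind (h l = e) * X l) := by
    intro e
    refine labelMean_ind_mul e a _ fun l v => ?_
    by_cases he : h l = e
    · have h1 := hh l v
      have h2 := hX l v
      rw [he] at h1 h2
      rw [h1, h2, he]
    -- If `e` were chosen after its label is changed, restoring the label would keep it chosen.
    · have he' : h (Function.update l e v) ≠ e := by
        intro hc
        have h1 := hh (Function.update l e v) (l e)
        rw [hc, Function.update_idem, Function.update_eq_self] at h1
        exact he h1
      rw [ind_of_not he, ind_of_not he', zero_mul, zero_mul]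
  have e1 : labelMean (fun l => ind (l (h l) = a) * X l) =
      ∑ e, labelMean (fun l => ind (l e = a) * (ind (h l = e) * X l)) := by
    rw [← labelMean_sum]
    congr 1
    ext l
    rw [sum_eq_single (h l) (fun e _ he => by rw [ind_of_not (P := h l = e) (Ne.symm he)]; ring)
      (by simp), ind_of (P := h l = h l) rfl, one_mul]
  have e2 : labelMean X = ∑ e, labelMean (fun l => ind (h l = e) * X l) := by
    rw [← labelMean_sum]
    congr 1
    ext l
    rw [← sum_mul, sum_ind_eq_one, one_mul]
  rw [e1, e2, mul_sum]
  exact sum_congr rfl fun e _ => key e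

end Labels

theorem labelProb_zero (k : ℕ) : labelProb k 0 = 1 / 2 := by simp [labelProb]

theorem labelProb_epoch {k : ℕ} {j : Fin (k + 2)} (h0 : (j : ℕ) ≠ 0) (hk : (j : ℕ) ≤ k) :
    labelProb k j = 1 / (100 * (k : ℝ)) := by simp [labelProb, h0, hk]

/-- An element of an epoch could as well be in the sample, where it is `50k` times as likely. -/
theorem labelMean_ind_epoch {Ω : Type u} [Fintype Ω] [DecidableEq Ω] {k : ℕ} (e : Ω)
    {t : Fin (k + 2)} (h0 : (t : ℕ) ≠ 0) (hk : (t : ℕ) ≤ k) (X : (Ω → Fin (k + 2)) → ℝ)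
    (hX : ∀ l v, X (Function.update l e v) = X l) :
    labelMean (fun l => ind (l e = t) * X l) =
      1 / (50 * (k : ℝ)) * labelMean (fun l => ind (l e = 0) * X l) := by
  have h := labelProb_mul_labelMean_ind e t 0 X hX
  rw [labelProb_zero, labelProb_epoch h0 hk] at h
  have hk0 : (k : ℝ) ≠ 0 := by
    have : k ≠ 0 := by omega
    exact_mod_cast this
  field_simp at h ⊢
  linarith

/-! From the arrival order and the block lengths to independent labels of the elements. -/

section Transfer

variable {Ω : Type u} [Fintype Ω] {k : ℕ}

/-- The arrivals in which the element `e` gets the label `l e`, and within each block the elements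
come in the order `σ`. -/
def arrivalOfLabels (σ : Fin (Fintype.card Ω) ≃ Ω) (l : Ω → Fin (k + 2)) : Arrival Ω k :=
  ((Tuple.sort (l ∘ σ)).trans σ, l ∘ σ)

theorem blockStart_eq_card (ω : Arrival Ω k) (j : ℕ) :
    blockStart ω j = (univ.filter (fun t => (ω.2 t : ℕ) < j)).card := by
  induction j with
  | zero => simp [blockStart]
  | succ j ih =>
    have h : blockStart ω (j + 1) = blockStart ω j + blockLength ω j := sum_range_succ _ _
    rw [h, ih, blockLength, ← card_union_of_disjoint]
    · congr 1
      ext t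
      simp only [mem_union, mem_filter, mem_univ, true_and]
      omega
    · rw [disjoint_filter]
      intro t _ h1 h2
      omega

/-- After sorting, labels are nondecreasing along the order, so the elements with label below `j`
fill an initial segment, and its length is `blockStart`. -/
theorem arrivalOfLabels_lt_blockStart (σ : Fin (Fintype.card Ω) ≃ Ω) (l : Ω → Fin (k + 2))
    (e : Ω) (j : ℕ) :
    ((arrivalOfLabels σ l).1.symm e : ℕ) < blockStart (arrivalOfLabels σ l) j ↔
      (l e : ℕ) < j := by
  set τ := Tuple.sort (l ∘ σ) with hτ
  have hm : Monotone (fun t => (((l ∘ σ) ∘ τ) t : ℕ)) := fun a b hab =>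
    Tuple.monotone_sort (l ∘ σ) hab
  have hc : blockStart (arrivalOfLabels σ l) j =
      (univ.filter (fun t => (((l ∘ σ) ∘ τ) t : ℕ) < j)).card := by
    rw [blockStart_eq_card]
    refine (card_equiv τ fun t => ?_).symm
    rw [mem_filter, mem_filter]
    simp [arrivalOfLabels]
  have h := Tuple.lt_card_lt_iff_apply_lt_of_monotone (a := j)
    (j := (arrivalOfLabels σ l).1.symm e) hm
  rw [hc, h]
  simp [arrivalOfLabels, hτ]

theorem mem_arrivedBefore_arrivalOfLabels (σ : Fin (Fintype.card Ω) ≃ Ω) (l : Ω → Fin (k + 2))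
    (e : Ω) (j : ℕ) :
    e ∈ arrivedBefore (arrivalOfLabels σ l) j ↔ (l e : ℕ) < j := by
  simp [arrivedBefore, arrivalOfLabels_lt_blockStart]

theorem mem_block_arrivalOfLabels (σ : Fin (Fintype.card Ω) ≃ Ω) (l : Ω → Fin (k + 2))
    (e : Ω) (j : ℕ) :
    e ∈ block (arrivalOfLabels σ l) j ↔ (l e : ℕ) = j := by
  rw [block, mem_filter, ← not_lt, arrivalOfLabels_lt_blockStart, arrivalOfLabels_lt_blockStart]
  simp only [mem_univ, true_and]
  omega

/-- Within a block the order of arrival is `σ`. -/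
theorem arrivalOfLabels_symm_le_iff (σ : Fin (Fintype.card Ω) ≃ Ω) (l : Ω → Fin (k + 2))
    {x y : Ω} (h : l x = l y) :
    (arrivalOfLabels σ l).1.symm x ≤ (arrivalOfLabels σ l).1.symm y ↔ σ.symm x ≤ σ.symm y := by
  have key : ∀ x y : Ω, l x = l y →
      (arrivalOfLabels σ l).1.symm x < (arrivalOfLabels σ l).1.symm y → σ.symm x < σ.symm y := by
    intro x y h hxy
    -- The sort is stable: equal labels stay in the order of `σ`.
    have h1 := (Tuple.eq_sort_iff (f := l ∘ σ)).1 rfl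
    have h2 := h1.2 _ _ hxy (by simp [arrivalOfLabels, h])
    simpa [arrivalOfLabels] using h2
  rw [← not_lt, ← not_lt, not_iff_not]
  refine ⟨key y x h.symm, fun hlt => ?_⟩
  by_contra hc
  rcases (not_lt.1 hc).lt_or_eq with h3 | h3
  · exact absurd (key x y h h3) (not_lt.2 hlt.le)
  · rw [(arrivalOfLabels σ l).1.symm.injective h3] at hlt
    exact lt_irrefl _ hlt

variable [DecidableEq Ω]

/-- Expectation over the arrival order and the epoch lengths. -/
noncomputable def arrivalMean (X : Arrival Ω k → ℝ) : ℝ := ∑ ω, arrivalWeight ω * X ω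

theorem arrivalProb_eq_arrivalMean (E : Arrival Ω k → Prop) :
    arrivalProb E = arrivalMean (fun ω => ind (E ω)) := by
  simp only [arrivalProb, arrivalMean, ind]
  exact sum_congr rfl fun ω _ => by split_ifs <;> simp

/-- For a fixed label sequence `L` on positions, composing with the sorting permutation of `L` is a
bijection of the orders, so the uniform order may be replaced by `σ` sorted stably by label. For a
fixed `σ`, reading `L` along `σ` as labels of elements preserves the product weight. -/
theorem arrivalMean_eq_sum_labelMean (X : Arrival Ω k → ℝ) :
    arrivalMean X = 1 / ((Fintype.card Ω).factorial : ℝ) *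
      ∑ σ : Fin (Fintype.card Ω) ≃ Ω, labelMean (fun l => X (arrivalOfLabels σ l)) := by
  have h1 : arrivalMean X = ∑ L : Fin (Fintype.card Ω) → Fin (k + 2),
      ∑ σ : Fin (Fintype.card Ω) ≃ Ω, 1 / ((Fintype.card Ω).factorial : ℝ) *
        ((∏ t, labelProb k (L t)) * X ((Tuple.sort L).trans σ, L)) := by
    rw [arrivalMean, Fintype.sum_prod_type, sum_comm]
    refine sum_congr rfl fun L _ => ?_
    refine (Fintype.sum_equiv ((Tuple.sort L).symm.equivCongr (Equiv.refl Ω)) _ _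
      fun σ => ?_).symm
    rw [arrivalWeight]
    simp only [Equiv.equivCongr, Equiv.coe_fn_mk, Equiv.symm_symm,
      Equiv.trans_refl]
    ring
  rw [h1, sum_comm, mul_sum]
  refine sum_congr rfl fun σ _ => ?_
  rw [← mul_sum, labelMean]
  congr 1
  refine Fintype.sum_equiv (σ.arrowCongr (Equiv.refl _)) _ _ fun L => ?_
  have hL : ((σ.arrowCongr (Equiv.refl (Fin (k + 2)))) L) ∘ σ = L := by
    ext t; simp
  rw [arrivalOfLabels, hL, labelWeight]
  congr 1
  exact Fintype.prod_equiv σ _ _ fun t => by simp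

theorem arrivalMean_const (a : ℝ) : arrivalMean (fun _ : Arrival Ω k => a) = a := by
  rw [arrivalMean, ← sum_mul, sum_arrivalWeight, one_mul]

/-- It suffices to compare expectations for every fixed order within the blocks. -/
theorem arrivalMean_le_of_labelMean_le {X Y : Arrival Ω k → ℝ}
    (h : ∀ σ, labelMean (fun l => X (arrivalOfLabels σ l)) ≤
      labelMean (fun l => Y (arrivalOfLabels σ l))) : arrivalMean X ≤ arrivalMean Y := by
  rw [arrivalMean_eq_sum_labelMean, arrivalMean_eq_sum_labelMean]
  exact mul_le_mul_of_nonneg_left (sum_le_sum fun σ _ => h σ) (by positivity)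

end Transfer

/-! The first element with a property, in a given order. -/

section FirstSat

variable {Ω : Type u} {n : ℕ}

open scoped Classical in
/-- The first element, in the order `σ`, that satisfies `p`. -/
noncomputable def firstSat (σ : Fin n ≃ Ω) (p : Ω → Prop) : Option Ω :=
  (List.ofFn σ).find? (fun e => decide (p e))

theorem firstSat_eq_none {σ : Fin n ≃ Ω} {p : Ω → Prop} :
    firstSat σ p = none ↔ ∀ x, ¬ p x := by
  simp only [firstSat, List.find?_eq_none, List.mem_ofFn, decide_eq_true_eq]
  exact ⟨fun h x => h x ⟨σ.symm x, by simp⟩, fun h x _ => h x⟩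

theorem firstSat_eq_some {σ : Fin n ≃ Ω} {p : Ω → Prop} {x : Ω} :
    firstSat σ p = some x ↔ p x ∧ ∀ y, p y → σ.symm x ≤ σ.symm y := by
  simp only [firstSat, List.find?_eq_some_iff_getElem, decide_eq_true_eq, List.length_ofFn,
    List.getElem_ofFn]
  refine and_congr_right fun _ => ⟨?_, fun h => ?_⟩
  · rintro ⟨i, hi, rfl, h⟩ y hy
    by_contra hc
    rw [not_le, Equiv.symm_apply_apply] at hc
    have := h (σ.symm y) hc
    simp [hy] at this
  · refine ⟨σ.symm x, (σ.symm x).2, by simp, fun j hj => ?_⟩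
    by_contra hc
    have hp : p (σ ⟨j, hj.trans (σ.symm x).2⟩) := by simpa using hc
    have := h _ hp
    rw [Equiv.symm_apply_apply] at this
    exact absurd hj (not_lt.2 this)

/-- Qualifying elements all lie in one block, so the candidate can be found with `σ` in place of the
arrival order. -/
theorem firstSat_congr {m : ℕ} {σ : Fin m ≃ Ω} {τ : Fin n ≃ Ω} {p : Ω → Prop}
    (h : ∀ x y, p x → p y → (σ.symm x ≤ σ.symm y ↔ τ.symm x ≤ τ.symm y)) :
    firstSat σ p = firstSat τ p := by
  cases h1 : firstSat σ p with
  | none => rw [eq_comm, firstSat_eq_none]; exact firstSat_eq_none.1 h1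
  | some x =>
    rw [firstSat_eq_some] at h1
    rw [eq_comm, firstSat_eq_some]
    exact ⟨h1.1, fun y hy => (h x y h1.1 hy).1 (h1.2 y hy)⟩

end FirstSat

/-! The order of the elements by value. -/

section Lower

variable {Ω : Type u} [LinearOrder Ω] {f : Finset Ω → ℝ} {S A : Finset Ω} {a b c : Ω}

theorem Lower.trans (h1 : Lower f S a b) (h2 : Lower f S b c) : Lower f S a c := by
  rcases h1 with h1 | ⟨h1, h1'⟩ <;> rcases h2 with h2 | ⟨h2, h2'⟩
  · exact Or.inl (h1.trans h2)
  · exact Or.inl (h2 ▸ h1)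
  · exact Or.inl (h1 ▸ h2)
  · exact Or.inr ⟨h1.trans h2, h1'.trans h2'⟩

theorem Lower.asymm (h1 : Lower f S a b) (h2 : Lower f S b a) : False := by
  rcases h1 with h1 | ⟨h1, h1'⟩ <;> rcases h2 with h2 | ⟨h2, h2'⟩
  · exact lt_asymm h1 h2
  · exact h1.ne h2.symm
  · exact h2.ne h1.symm
  · exact lt_asymm h1' h2'

theorem lower_or_lower (h : a ≠ b) : Lower f S a b ∨ Lower f S b a := by
  unfold Lower
  rcases lt_trichotomy (marginal f S {a}) (marginal f S {b}) with h1 | h1 | h1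
  · exact Or.inl (Or.inl h1)
  · rcases lt_or_gt_of_ne h with h2 | h2
    · exact Or.inl (Or.inr ⟨h1, h2⟩)
    · exact Or.inr (Or.inr ⟨h1.symm, h2⟩)
  · exact Or.inr (Or.inl h1)

theorem Lower.marginal_le (h : Lower f S a b) : marginal f S {a} ≤ marginal f S {b} := by
  rcases h with h | ⟨h, _⟩
  · exact h.le
  · exact h.le

theorem exists_isHighest (hA : A.Nonempty) : ∃ e, IsHighest f S A e := by
  induction hA using Finset.Nonempty.cons_induction with
  | singleton a => exact ⟨a, by simp [IsHighest]⟩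
  | cons a s ha hs ih =>
    obtain ⟨e, he, hmax⟩ := ih
    have hne : a ≠ e := fun h => ha (h ▸ he)
    rcases lower_or_lower (f := f) (S := S) hne with h | h
    · refine ⟨e, mem_cons_of_mem he, fun e' he' hne' => ?_⟩
      rcases mem_cons.1 he' with rfl | he'
      · exact h
      · exact hmax e' he' hne'
    · refine ⟨a, mem_cons_self _ _, fun e' he' hne' => ?_⟩
      have he'' := (mem_cons.1 he').resolve_left hne'
      by_cases h' : e' = e
      · exact h' ▸ h
      · exact (hmax e' he'' h').trans h

theorem IsHighest.unique (ha : IsHighest f S A a) (hb : IsHighest f S A b) : a = b := by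
  by_contra h
  exact (ha.2 b hb.1 (Ne.symm h)).asymm (hb.2 a ha.1 h)

end Lower

/-! The algorithm in terms of the labels. -/

section LabelModel

variable {Ω : Type u} [LinearOrder Ω] {k n : ℕ}

/-- The labelled version of `Qualifies`. -/
def LabelQualifies (g : Ω → Fin k) (f : Finset Ω → ℝ) (l : Ω → Fin (k + 2)) (S : Finset Ω)
    (j : ℕ) (e : Ω) : Prop :=
  (l e : ℕ) = j ∧ (∀ s ∈ S, g s ≠ g e) ∧ ∀ e', (l e' : ℕ) < j → g e' = g e → Lower f S e' e

/-- The labelled version of `EventF`. -/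
def LabelEventF (g : Ω → Fin k) (f : Finset Ω → ℝ) (l : Ω → Fin (k + 2)) (S : Finset Ω)
    (i : Fin k) (j : ℕ) : Prop :=
  ∃ e, g e = i ∧ (l e : ℕ) = j ∧ ∀ e', g e' = i → (l e' : ℕ) ≤ j → e' ≠ e → Lower f S e' e

/-- The candidate of epoch `j` if the groups in `M` are ignored. -/
noncomputable def maskedCandidate (σ : Fin n ≃ Ω) (g : Ω → Fin k) (f : Finset Ω → ℝ)
    (M : Fin k → Prop) (l : Ω → Fin (k + 2)) (S : Finset Ω) (j : ℕ) : Option Ω :=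
  firstSat σ (fun e => ¬ M (g e) ∧ LabelQualifies g f l S j e)

/-- Epoch `t + 1`, starting with the set `S`, if the groups in `M` are ignored; the Boolean `a t`
says whether the candidate is kept. -/
noncomputable def maskedStep (σ : Fin n ≃ Ω) (g : Ω → Fin k) (f : Finset Ω → ℝ) (a : ℕ → Bool)
    (M : Fin k → Prop) (l : Ω → Fin (k + 2)) (t : ℕ) (S : Finset Ω) : Finset Ω :=
  match maskedCandidate σ g f M l S (t + 1) with
  | none => S
  | some x => if a t then insert x S else S

/-- The epochs `t + 1, …, t + d`, starting with the set `S`. -/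
noncomputable def maskedRun (σ : Fin n ≃ Ω) (g : Ω → Fin k) (f : Finset Ω → ℝ) (a : ℕ → Bool)
    (M : Fin k → Prop) (l : Ω → Fin (k + 2)) : ℕ → Finset Ω → ℕ → Finset Ω
  | _, S, 0 => S
  | t, S, d + 1 => maskedRun σ g f a M l (t + 1) (maskedStep σ g f a M l t S) d

variable {σ : Fin n ≃ Ω} {g : Ω → Fin k} {f : Finset Ω → ℝ} {a : ℕ → Bool} {M : Fin k → Prop}
  {l l' : Ω → Fin (k + 2)} {S : Finset Ω} {i : Fin k}

theorem maskedRun_succ (t : ℕ) (S : Finset Ω) (d : ℕ) :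
    maskedRun σ g f a M l t S (d + 1) =
      maskedStep σ g f a M l (t + d) (maskedRun σ g f a M l t S d) := by
  induction d generalizing t S with
  | zero => rfl
  | succ d ih =>
    rw [maskedRun, ih, maskedRun, show t + 1 + d = t + (d + 1) by ring]

theorem maskedCandidate_spec {x : Ω} {j : ℕ} (h : maskedCandidate σ g f M l S j = some x) :
    ¬ M (g x) ∧ LabelQualifies g f l S j x := (firstSat_eq_some.1 h).1

theorem maskedStep_eq_or (t : ℕ) (S : Finset Ω) : maskedStep σ g f a M l t S = S ∨
    ∃ x, ¬ M (g x) ∧ LabelQualifies g f l S (t + 1) x ∧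
      maskedStep σ g f a M l t S = insert x S := by
  unfold maskedStep
  cases h : maskedCandidate σ g f M l S (t + 1) with
  | none => exact Or.inl rfl
  | some x =>
    cases a t with
    | false => exact Or.inl rfl
    | true => exact Or.inr ⟨x, (maskedCandidate_spec h).1, (maskedCandidate_spec h).2, rfl⟩

/-- Nothing is selected from an ignored group. -/
theorem not_mask_of_mem_maskedRun {t d : ℕ} (hS : ∀ e ∈ S, ¬ M (g e)) :
    ∀ e ∈ maskedRun σ g f a M l t S d, ¬ M (g e) := by
  induction d generalizing t S with
  | zero => exact hS
  | succ d ih =>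
    refine ih fun e he => ?_
    rcases maskedStep_eq_or (σ := σ) (g := g) (f := f) (a := a) (M := M) (l := l) t S with
      h | ⟨x, hx, _, h⟩
    · exact hS e (h ▸ he)
    · rw [h, mem_insert] at he
      rcases he with rfl | he
      · exact hx
      · exact hS e he

/-- Whether an element qualifies depends only on `S` and the labels of its own group. -/
theorem maskedStep_congr (h : ∀ e, ¬ M (g e) → l e = l' e) (t : ℕ) (S : Finset Ω) :
    maskedStep σ g f a M l t S = maskedStep σ g f a M l' t S := by
  have hq : (fun e => ¬ M (g e) ∧ LabelQualifies g f l S (t + 1) e) =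
      fun e => ¬ M (g e) ∧ LabelQualifies g f l' S (t + 1) e := by
    funext e
    refine propext (and_congr_right fun he => ?_)
    unfold LabelQualifies
    rw [h e he]
    refine and_congr_right fun _ => and_congr_right fun _ => forall_congr' fun e' => ?_
    constructor
    · intro hl h1 h2; exact hl (by rwa [h e' (h2 ▸ he)]) h2
    · intro hl h1 h2; exact hl (by rwa [← h e' (h2 ▸ he)]) h2
  simp only [maskedStep, maskedCandidate, hq]

/-- The labels of the ignored groups do not matter. -/
theorem maskedRun_congr (h : ∀ e, ¬ M (g e) → l e = l' e) (t : ℕ) (S : Finset Ω) (d : ℕ) :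
    maskedRun σ g f a M l t S d = maskedRun σ g f a M l' t S d := by
  induction d generalizing t S with
  | zero => rfl
  | succ d ih => rw [maskedRun, maskedRun, maskedStep_congr h, ih]

/-- Ignoring one more group changes an epoch only if the candidate is from this group. -/
theorem maskedStep_or_eq (i : Fin k) (t : ℕ) (S : Finset Ω) :
    maskedStep σ g f a M l t S = maskedStep σ g f a (fun x => M x ∨ x = i) l t S ∨
      ∃ x, g x = i ∧ LabelQualifies g f l S (t + 1) x ∧
        maskedStep σ g f a M l t S = insert x S := by
  cases h : maskedCandidate σ g f M l S (t + 1) with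
  | none =>
    have h' : maskedCandidate σ g f (fun x => M x ∨ x = i) l S (t + 1) = none := by
      rw [maskedCandidate, firstSat_eq_none] at h ⊢
      exact fun x hx => h x ⟨fun hM => hx.1 (Or.inl hM), hx.2⟩
    left
    simp only [maskedStep, h, h']
  | some x =>
    by_cases hx : g x = i
    · cases ha : a t with
      | false =>
        left
        simp only [maskedStep, ha]
        cases maskedCandidate σ g f M l S (t + 1) <;>
          cases maskedCandidate σ g f (fun x => M x ∨ x = i) l S (t + 1) <;> simp
      | true => exact Or.inr ⟨x, hx, (maskedCandidate_spec h).2, by simp [maskedStep, h, ha]⟩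
    · have h' : maskedCandidate σ g f (fun x => M x ∨ x = i) l S (t + 1) = some x := by
        rw [maskedCandidate, firstSat_eq_some] at h ⊢
        refine ⟨⟨fun hM => hM.elim h.1.1 hx, h.1.2⟩, fun y hy => h.2 y ⟨?_, hy.2⟩⟩
        exact fun hM => hy.1 (Or.inl hM)
      left
      simp only [maskedStep, h, h']

/-- A group that is represented in the set already may as well be ignored. -/
theorem maskedRun_or_eq_of_mem {x : Ω} (hxi : g x = i) (t d : ℕ) (hx : x ∈ S) :
    maskedRun σ g f a M l t S d = maskedRun σ g f a (fun y => M y ∨ y = i) l t S d := by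
  induction d generalizing t S with
  | zero => rfl
  | succ d ih =>
    rw [maskedRun, maskedRun]
    rcases maskedStep_or_eq (σ := σ) (g := g) (f := f) (a := a) (M := M) (l := l) i t S with
      h | ⟨y, hy, hq, _⟩
    · rw [← h]
      refine ih _ ?_
      rcases maskedStep_eq_or (σ := σ) (g := g) (f := f) (a := a) (M := M) (l := l) t S with
        h' | ⟨y, _, _, h'⟩
      · rwa [h']
      · rw [h']; exact mem_insert_of_mem hx
    · exact absurd (hxi.trans hy.symm) (hq.2.1 x hx)

variable [Fintype Ω]

/-- If an element of a group qualifies, then the highest element of its group seen so far is in the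
current epoch. -/
theorem LabelQualifies.labelEventF {x : Ω} {j : ℕ} (h : LabelQualifies g f l S j x) :
    LabelEventF g f l S (g x) j := by
  obtain ⟨e, he, hmax⟩ := exists_isHighest (f := f) (S := S)
    (A := univ.filter fun e => g e = g x ∧ (l e : ℕ) ≤ j) ⟨x, by simp [h.1]⟩
  simp only [mem_filter, mem_univ, true_and] at he hmax
  refine ⟨e, he.1, ?_, fun e' h1 h2 h3 => hmax e' ⟨h1, h2⟩ h3⟩
  by_contra hne
  have hlt : (l e : ℕ) < j := lt_of_le_of_ne he.2 hne
  have hxe : x ≠ e := by rintro rfl; exact hne h.1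
  exact (h.2.2 e hlt he.1).asymm (hmax x ⟨rfl, h.1.le⟩ hxe)

/-- Ignoring a group changes nothing as long as its highest element seen so far is never in the
current epoch. -/
theorem maskedRun_eq_of_not_labelEventF {d : ℕ}
    (h : ∀ t < d, ¬ LabelEventF g f l
      (maskedRun σ g f a (fun x => M x ∨ x = i) l 0 S t) i (t + 1)) :
    maskedRun σ g f a M l 0 S d = maskedRun σ g f a (fun x => M x ∨ x = i) l 0 S d := by
  induction d with
  | zero => rfl
  | succ d ih =>
    rw [maskedRun_succ, maskedRun_succ, ih fun t ht => h t (ht.trans d.lt_succ_self), zero_add]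
    rcases maskedStep_or_eq (σ := σ) (g := g) (f := f) (a := a) (M := M) (l := l) i d
      (maskedRun σ g f a (fun x => M x ∨ x = i) l 0 S d) with h' | ⟨x, hx, hq, _⟩
    · exact h'
    · exact absurd (hx ▸ hq.labelEventF) (h d d.lt_succ_self)

/-- `X l` does not depend on the labels of the elements of group `i`. -/
def IndepOfGroup {β : Type*} (g : Ω → Fin k) (i : Fin k) (X : (Ω → Fin (k + 2)) → β) : Prop :=
  ∀ l l', (∀ e, g e ≠ i → l e = l' e) → X l = X l'

theorem IndepOfGroup.update {β : Type*} {X : (Ω → Fin (k + 2)) → β} (h : IndepOfGroup g i X)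
    {y : Ω} (hy : g y = i) (l : Ω → Fin (k + 2)) (v : Fin (k + 2)) :
    X (Function.update l y v) = X l :=
  h _ _ fun e he => Function.update_of_ne (fun h' => he (by rw [h', hy])) _ _

theorem IndepOfGroup.comp {β γ : Type*} {X : (Ω → Fin (k + 2)) → β} (h : IndepOfGroup g i X)
    (F : β → γ) : IndepOfGroup g i (fun l => F (X l)) := fun l l' hl => congrArg F (h l l' hl)

theorem IndepOfGroup.run {T : (Ω → Fin (k + 2)) → Finset Ω} (hT : IndepOfGroup g i T)
    (hi : M i) (t d : ℕ) :
    IndepOfGroup g i (fun l => maskedRun σ g f a M l t (T l) d) := fun l l' hl => by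
  simp only [hT l l' hl]
  exact maskedRun_congr (fun e he => hl e fun h => he (h ▸ hi)) _ _ _

theorem IndepOfGroup.step {T : (Ω → Fin (k + 2)) → Finset Ω} (hT : IndepOfGroup g i T)
    (hi : M i) (t : ℕ) :
    IndepOfGroup g i (fun l => maskedStep σ g f a M l t (T l)) :=
  hT.run (σ := σ) (f := f) (a := a) hi t 1

/-- Given the sets used for the valuation, the highest element of a group seen so far is in the
current epoch with probability at most `1 / (50k)`. -/
theorem labelMean_labelEventF_mul_le {T : (Ω → Fin (k + 2)) → Finset Ω}
    (hT : IndepOfGroup g i T) {t : ℕ} (h0 : t ≠ 0) (hk : t ≤ k) (Q : (Ω → Fin (k + 2)) → ℝ)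
    (hQ0 : ∀ l, 0 ≤ Q l)
    (hQ : ∀ l y, g y = i → (l y : ℕ) = t → Q l ≤ Q (Function.update l y 0)) :
    labelMean (fun l => ind (LabelEventF g f l (T l) i t) * Q l) ≤
      1 / (50 * (k : ℝ)) * labelMean Q := by
  let j : Fin (k + 2) := ⟨t, by omega⟩
  have hj : ∀ l : Ω → Fin (k + 2), ∀ y, (l y : ℕ) = t ↔ l y = j := fun l y => by
    rw [Fin.ext_iff]
  let top : Ω → (Ω → Fin (k + 2)) → Prop := fun y l =>
    g y = i ∧ ∀ e', g e' = i → (l e' : ℕ) ≤ t → e' ≠ y → Lower f (T l) e' y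
  -- Evaluating `Q` with `y` already moved to the sample makes `X y` independent of the label of
  -- `y`; by `hQ` this only increases the value.
  let X : Ω → (Ω → Fin (k + 2)) → ℝ := fun y l => ind (top y l) * Q (Function.update l y 0)
  have htop : ∀ y l v, top y (Function.update l y v) ↔ top y l := by
    intro y l v
    refine and_congr_right fun hy => ?_
    rw [hT.update hy]
    refine forall_congr' fun e' => forall_congr' fun _ => ?_
    by_cases he : e' = y
    · simp [he]
    · rw [Function.update_of_ne he]
  have hX : ∀ y l v, X y (Function.update l y v) = X y l := by
    intro y l v
    simp only [X, Function.update_idem, ind_congr (htop y l v)]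
  have h1 : labelMean (fun l => ind (LabelEventF g f l (T l) i t) * Q l) ≤
      labelMean (fun l => ∑ y, ind (l y = j) * X y l) := by
    refine labelMean_mono fun l => ?_
    refine (mul_le_mul_of_nonneg_right (ind_exists_le_sum _) (hQ0 l)).trans ?_
    rw [sum_mul]
    refine sum_le_sum fun y _ => ?_
    by_cases hy : g y = i ∧ (l y : ℕ) = t
    · rw [← and_assoc, and_comm (a := g y = i), and_assoc, ind_and, mul_assoc,
        ind_congr (hj l y)]
      exact mul_le_mul_of_nonneg_left
        (mul_le_mul_of_nonneg_left (hQ l y hy.1 hy.2) (ind_nonneg _)) (ind_nonneg _)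
    · rw [ind_of_not fun h => hy ⟨h.1, h.2.1⟩, zero_mul]
      exact mul_nonneg (ind_nonneg _) (mul_nonneg (ind_nonneg _) (hQ0 _))
  refine h1.trans ?_
  rw [labelMean_sum, sum_congr rfl fun y _ => labelMean_ind_epoch y h0 hk (X y) (hX y), ← mul_sum,
    ← labelMean_sum]
  refine mul_le_mul_of_nonneg_left (labelMean_mono fun l => ?_) (by positivity)
  have h2 : ∀ y, ind (l y = 0) * X y l = ind (l y = 0 ∧ top y l) * Q l := by
    intro y
    by_cases hy : l y = 0
    · have : Function.update l y 0 = l := by rw [← hy, Function.update_eq_self]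
      simp only [X, this, ind_and]
      ring
    · rw [ind_of_not hy, ind_of_not fun h => hy h.1]
      ring
  simp only [h2]
  rw [← sum_mul]
  -- Two such elements, both with label `0 ≤ t`, would each have to beat the other.
  refine mul_le_of_le_one_left (hQ0 l) (sum_ind_le_one _ fun x y hx hy => ?_)
  by_contra hne
  exact (hx.2.2 y hy.2.1 (by simp [hy.1]) (Ne.symm hne)).asymm
    (hy.2.2 x hx.2.1 (by simp [hx.1]) hne)

/-- At most two pairs `(x, e)` are such that `x` and `e` would dominate the other elements of their
group under a first valuation and under a second one, which may depend on `x`. -/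
theorem sum_ind_pair_le_two (Z : Ω → Prop) (V : Ω → Finset Ω) (S : Finset Ω) :
    ∑ p : Ω × Ω, ind ((Z p.1 ∧ Z p.2 ∧ p.1 ≠ p.2) ∧
      (∀ e', Z e' → e' ≠ p.1 → e' ≠ p.2 → Lower f S e' p.1) ∧
      (∀ e', Z e' → e' ≠ p.1 → e' ≠ p.2 → Lower f (V p.1) e' p.2)) ≤ 2 := by
  set P : Ω × Ω → Prop := fun p => (Z p.1 ∧ Z p.2 ∧ p.1 ≠ p.2) ∧
      (∀ e', Z e' → e' ≠ p.1 → e' ≠ p.2 → Lower f S e' p.1) ∧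
      (∀ e', Z e' → e' ≠ p.1 → e' ≠ p.2 → Lower f (V p.1) e' p.2) with hP
  have hsplit : ∀ p, ind (P p) = ind (P p ∧ Lower f S p.2 p.1) + ind (P p ∧ Lower f S p.1 p.2) := by
    intro p
    by_cases h : P p
    · rcases lower_or_lower (f := f) (S := S) h.1.2.2 with h1 | h1
      · rw [ind_of h, ind_of_not fun h' => h1.asymm h'.2, ind_of ⟨h, h1⟩]; norm_num
      · rw [ind_of h, ind_of ⟨h, h1⟩, ind_of_not fun h' => h1.asymm h'.2]; norm_num
    · rw [ind_of_not h, ind_of_not fun h' => h h'.1, ind_of_not fun h' => h h'.1]; norm_num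
  have hsnd : ∀ p q : Ω × Ω, P p → P q → p.1 = q.1 → p = q := by
    intro p q hp hq h
    refine Prod.ext h ?_
    by_contra hne
    exact (hp.2.2 q.2 hq.1.2.1 (h ▸ hq.1.2.2.symm) (Ne.symm hne)).asymm
      (h ▸ hq.2.2 p.2 hp.1.2.1 (h ▸ hp.1.2.2.symm) hne)
  -- Here `p.1` is the highest element under `f_S`; it determines `V p.1` and thereby `p.2`.
  have h1 : ∑ p, ind (P p ∧ Lower f S p.2 p.1) ≤ 1 := by
    refine sum_ind_le_one _ fun p q hp hq => hsnd p q hp.1 hq.1 ?_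
    have key : ∀ p q : Ω × Ω, (P p ∧ Lower f S p.2 p.1) → P q → p.1 ≠ q.1 →
        Lower f S q.1 p.1 := by
      intro p q hp hq hne
      by_cases h : q.1 = p.2
      · exact h ▸ hp.2
      · exact hp.1.2.1 q.1 hq.1.1 hne.symm h
    by_contra hne
    exact (key p q hp hq.1 hne).asymm (key q p hq hp.1 (Ne.symm hne))
  -- Here `p.2` is the highest element under `f_S` and `p.1` the second highest.
  have h2 : ∑ p, ind (P p ∧ Lower f S p.1 p.2) ≤ 1 := by
    have top : ∀ p : Ω × Ω, (P p ∧ Lower f S p.1 p.2) → ∀ e, Z e → e ≠ p.2 →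
        Lower f S e p.2 := by
      intro p hp e he hne
      by_cases h : e = p.1
      · exact h ▸ hp.2
      · exact (hp.1.2.1 e he h hne).trans hp.2
    refine sum_ind_le_one _ fun p q hp hq => hsnd p q hp.1 hq.1 ?_
    have h : p.2 = q.2 := by
      by_contra hne
      exact (top p hp q.2 hq.1.1.2.1 (Ne.symm hne)).asymm (top q hq p.2 hp.1.1.2.1 hne)
    by_contra hne
    exact (hp.1.2.1 q.1 hq.1.1.1 (Ne.symm hne) (h ▸ hq.1.1.2.2)).asymm
      (hq.1.2.1 p.1 hp.1.1.1 hne (h ▸ hp.1.1.2.2))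
  rw [sum_congr rfl fun p _ => hsplit p, sum_add_distrib]
  linarith

/-- The probability that an element of group `i` can be selected in an epoch and, for the valuation
that results, the highest element of the group seen so far is in a given later epoch. -/
theorem labelMean_labelEventF_pair_le {T : (Ω → Fin (k + 2)) → Finset Ω}
    (hT : IndepOfGroup g i T) {V : Ω → (Ω → Fin (k + 2)) → Finset Ω}
    (hV : ∀ x, IndepOfGroup g i (V x)) {t s : ℕ} (h0 : t ≠ 0) (hts : t < s) (hk : s ≤ k) :
    labelMean (fun l => ind (∃ x, g x = i ∧ LabelQualifies g f l (T l) t x ∧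
      LabelEventF g f l (V x l) i s)) ≤ 2 * (1 / (50 * (k : ℝ))) ^ 2 := by
  let jt : Fin (k + 2) := ⟨t, by omega⟩
  let js : Fin (k + 2) := ⟨s, by omega⟩
  -- Both comparisons leave out the pair itself, so that `Z p` does not depend on the labels of
  -- `p.1` and `p.2`, and both can be moved to the sample, at a factor `1/(50k)` each.
  let Z : Ω × Ω → (Ω → Fin (k + 2)) → Prop := fun p l =>
    (g p.1 = i ∧ g p.2 = i ∧ p.1 ≠ p.2) ∧
      (∀ e', g e' = i → (l e' : ℕ) < t → e' ≠ p.1 → e' ≠ p.2 → Lower f (T l) e' p.1) ∧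
      (∀ e', g e' = i → (l e' : ℕ) ≤ s → e' ≠ p.1 → e' ≠ p.2 → Lower f (V p.1 l) e' p.2)
  have hZ : ∀ p l y v, (y = p.1 ∨ y = p.2) → (Z p (Function.update l y v) ↔ Z p l) := by
    intro p l y v hy
    refine and_congr_right fun hp => ?_
    have hyi : g y = i := by rcases hy with rfl | rfl; exacts [hp.1, hp.2.1]
    rw [hT.update hyi, (hV p.1).update hyi]
    have hu : ∀ e', e' ≠ p.1 → e' ≠ p.2 → Function.update l y v e' = l e' := by
      intro e' h1 h2
      refine Function.update_of_ne ?_ _ _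
      rcases hy with rfl | rfl <;> assumption
    refine and_congr ?_ ?_ <;> refine forall_congr' fun e' => forall_congr' fun _ => ?_ <;>
    · constructor
      · intro h h1 h2 h3; exact h (by rwa [hu e' h2 h3]) h2 h3
      · intro h h1 h2 h3; exact h (by rwa [← hu e' h2 h3]) h2 h3
  have h1 : ∀ l : Ω → Fin (k + 2), ind (∃ x, g x = i ∧ LabelQualifies g f l (T l) t x ∧
      LabelEventF g f l (V x l) i s) ≤
      ∑ p : Ω × Ω, ind (l p.1 = jt) * (ind (l p.2 = js) * ind (Z p l)) := by
    intro l
    refine (ind_mono (Q := ∃ p : Ω × Ω, l p.1 = jt ∧ l p.2 = js ∧ Z p l) ?_).trans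
      ((ind_exists_le_sum _).trans (sum_le_sum fun p _ => by rw [ind_and, ind_and]))
    rintro ⟨x, hx, hq, e, he, hes, hmax⟩
    have hne : x ≠ e := by
      rintro rfl
      exact hts.ne (hq.1.symm.trans hes)
    exact ⟨(x, e), Fin.ext hq.1, Fin.ext hes, ⟨hx, he, hne⟩,
      fun e' h1 h2 _ _ => hq.2.2 e' h2 (h1.trans hx.symm), fun e' h1 h2 _ h3 => hmax e' h1 h2 h3⟩
  refine (labelMean_mono h1).trans ?_
  rw [labelMean_sum]
  have h2 : ∀ p : Ω × Ω, labelMean (fun l => ind (l p.1 = jt) * (ind (l p.2 = js) * ind (Z p l))) =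
      (1 / (50 * (k : ℝ))) ^ 2 *
        labelMean (fun l => ind (l p.1 = 0) * (ind (l p.2 = 0) * ind (Z p l))) := by
    intro p
    by_cases hp : p.1 = p.2
    · have : ∀ l, ind (Z p l) = 0 := fun l => ind_of_not fun h => h.1.2.2 hp
      simp [this, labelMean_const]
    · rw [labelMean_ind_epoch p.1 h0 (hts.le.trans hk)]
      · have : ∀ l : Ω → Fin (k + 2), ind (l p.1 = 0) * (ind (l p.2 = js) * ind (Z p l)) =
            ind (l p.2 = js) * (ind (l p.1 = 0) * ind (Z p l)) := fun l => by ring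
        simp only [this]
        rw [labelMean_ind_epoch p.2 (t := js) (by simp only [js]; omega) hk]
        · have : ∀ l : Ω → Fin (k + 2), ind (l p.2 = 0) * (ind (l p.1 = 0) * ind (Z p l)) =
            ind (l p.1 = 0) * (ind (l p.2 = 0) * ind (Z p l)) := fun l => by ring
          simp only [this]
          ring
        · intro l v
          rw [Function.update_of_ne hp, ind_congr (hZ p l p.2 v (Or.inr rfl))]
      · intro l v
        rw [Function.update_of_ne (Ne.symm hp), ind_congr (hZ p l p.1 v (Or.inl rfl))]
  rw [sum_congr rfl fun p _ => h2 p, ← mul_sum, ← labelMean_sum, mul_comm]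
  refine mul_le_mul_of_nonneg_right ?_ (by positivity)
  refine (labelMean_mono (Y := fun _ => 2) fun l => ?_).trans (labelMean_const _).le
  refine le_trans (sum_le_sum fun p _ => ?_)
    (sum_ind_pair_le_two (f := f) (fun e => l e = 0 ∧ g e = i) (fun x => V x l) (T l))
  rw [← ind_and, ← ind_and]
  refine ind_mono fun h => ⟨⟨⟨h.1, h.2.2.1.1⟩, ⟨h.2.1, h.2.2.1.2.1⟩, h.2.2.1.2.2⟩, ?_, ?_⟩
  · exact fun e' he' h1 h2 => h.2.2.2.1 e' he'.2 (by simp [he'.1]; omega) h1 h2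
  · exact fun e' he' h1 h2 => h.2.2.2.2 e' he'.2 (by simp [he'.1]) h1 h2

/-- The probability that the highest element of group `i` seen until the end of epoch `t + d + 1`
falls into this epoch, for the valuation used there by the algorithm. -/
theorem labelMean_labelEventF_maskedRun_le (d : ℕ) {t : ℕ} (hk : t + d + 1 ≤ k)
    {T : (Ω → Fin (k + 2)) → Finset Ω} (hT : IndepOfGroup g i T) :
    labelMean (fun l => ind (LabelEventF g f l (maskedRun σ g f a M l t (T l) d) i (t + d + 1))) ≤
      1 / (50 * (k : ℝ)) + d * (2 * (1 / (50 * (k : ℝ))) ^ 2) := by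
  induction d generalizing t T with
  | zero =>
    have h := labelMean_labelEventF_mul_le (f := f) hT (t := t + 1) (by omega) (by omega)
      (fun _ => 1) (fun _ => zero_le_one) (fun _ _ _ _ => le_rfl)
    simpa [labelMean_const, maskedRun] using h
  | succ d ih =>
    -- Either the next epoch acts as if group `i` were ignored, and `U` is again independent of the
    -- group, so that induction applies; or some `x` of the group is selected, and from then on the
    -- run is `V x`, which ignores the group.
    let U : (Ω → Fin (k + 2)) → Finset Ω := fun l =>
      maskedStep σ g f a (fun x => M x ∨ x = i) l t (T l)
    have hU : IndepOfGroup g i U := hT.step (Or.inr rfl) t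
    let V : Ω → (Ω → Fin (k + 2)) → Finset Ω := fun x l =>
      maskedRun σ g f a (fun x => M x ∨ x = i) l (t + 1) (insert x (T l)) d
    have hV : ∀ x, IndepOfGroup g i (V x) := fun x =>
      (hT.comp (insert x)).run (Or.inr rfl) (t + 1) d
    have e : t + (d + 1) + 1 = t + 1 + d + 1 := by ring
    have h1 := ih (t := t + 1) (by omega) hU
    have h2 := labelMean_labelEventF_pair_le (f := f) hT hV (t := t + 1) (s := t + 1 + d + 1)
      (by omega) (by omega) (by omega)
    have h3 : labelMean (fun l => ind (LabelEventF g f l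
        (maskedRun σ g f a M l t (T l) (d + 1)) i (t + (d + 1) + 1))) ≤
        labelMean (fun l =>
          ind (LabelEventF g f l (maskedRun σ g f a M l (t + 1) (U l) d) i (t + 1 + d + 1)) +
          ind (∃ x, g x = i ∧ LabelQualifies g f l (T l) (t + 1) x ∧
            LabelEventF g f l (V x l) i (t + 1 + d + 1))) := by
      refine labelMean_mono fun l => ?_
      rw [e, maskedRun]
      rcases maskedStep_or_eq (σ := σ) (g := g) (f := f) (a := a) (M := M) (l := l) i t (T l) with
        h | ⟨x, hx, hq, h⟩
      · rw [h]
        exact le_add_of_nonneg_right (ind_nonneg _)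
      · rw [h, maskedRun_or_eq_of_mem hx _ _ (mem_insert_self _ _)]
        exact (ind_mono fun h' => ⟨x, hx, hq, h'⟩).trans (le_add_of_nonneg_left (ind_nonneg _))
    refine h3.trans ?_
    rw [labelMean_add]
    push_cast
    linarith

end LabelModel

/-! The good event. -/

section Good

variable {Ω : Type u} [Fintype Ω] [LinearOrder Ω] {k : ℕ} {g : Ω → Fin k} {f : Finset Ω → ℝ}
  {S : Finset Ω} {i : Fin k} {j : ℕ}

theorem mem_groupSet {e : Ω} : e ∈ groupSet g i ↔ g e = i := by simp [groupSet]

theorem mem_arrivedBefore_succ {ω : Arrival Ω k} {e : Ω} :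
    e ∈ arrivedBefore ω (j + 1) ↔ e ∈ arrivedBefore ω j ∨ e ∈ block ω j := by
  have h : blockStart ω (j + 1) = blockStart ω j + blockLength ω j := sum_range_succ _ _
  simp only [arrivedBefore, block, mem_filter, mem_univ, true_and]
  omega

theorem Qualifies.eventF {ω : Arrival Ω k} {x : Ω} (h : Qualifies g f ω S j x) :
    EventF g f ω S (g x) j := by
  have hx : x ∈ groupSet g (g x) ∩ arrivedBefore ω (j + 1) :=
    mem_inter.2 ⟨mem_groupSet.2 rfl, mem_arrivedBefore_succ.2 (Or.inr h.1)⟩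
  obtain ⟨e, he⟩ := exists_isHighest (f := f) (S := S) ⟨x, hx⟩
  refine ⟨e, he, ?_⟩
  have hm := mem_inter.1 he.1
  refine (mem_arrivedBefore_succ.1 hm.2).resolve_left fun hb => ?_
  have h1 := h.2.2 e hb (mem_groupSet.1 hm.1)
  have hne : x ≠ e := by rintro rfl; exact h1.asymm h1
  exact h1.asymm (he.2 x hx hne)

theorem candidate_eq_firstSat (ω : Arrival Ω k) :
    candidate g f ω S j = firstSat ω.1 (Qualifies g f ω S j) := rfl

/-- If the good event happens for a group, then the candidate is its highest element. -/
theorem GoodEvent.candidate_eq {ω : Arrival Ω k} (h : GoodEvent g f ω S i j) :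
    ∃ e, IsHighest f S (groupSet g i) e ∧ candidate g f ω S j = some e := by
  obtain ⟨⟨⟨e, he, heb⟩, hs, hp⟩, hF⟩ := h
  have hei : g e = i := mem_groupSet.1 he.1
  refine ⟨e, he, ?_⟩
  rw [candidate_eq_firstSat, firstSat_eq_some]
  have hnb : e ∉ arrivedBefore ω j := by
    simp only [arrivedBefore, block, mem_filter, mem_univ, true_and] at heb ⊢
    omega
  refine ⟨⟨heb, fun s hsS hsg => hp ⟨s, hsS, hsg.trans hei⟩, fun e' hb hg => ?_⟩, fun y hy => ?_⟩
  · refine he.2 e' (mem_groupSet.2 (hg.trans hei)) ?_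
    rintro rfl
    exact hnb hb
  · by_cases hgy : g y = i
    · have hye : y = e := by
        by_contra hne
        have hy1 : y ∈ (groupSet g i).erase e := mem_erase.2 ⟨hne, mem_groupSet.2 hgy⟩
        -- The second highest element `b` arrived earlier, so only the highest element can beat
        -- everything seen before.
        obtain ⟨b, hb⟩ := exists_isHighest (f := f) (S := S) ⟨y, hy1⟩
        have h1 := hy.2.2 b (hs e b he hb) ((mem_groupSet.1 (mem_of_mem_erase hb.1)).trans hgy.symm)
        have hyb : y ≠ b := by rintro rfl; exact h1.asymm h1
        exact h1.asymm (hb.2 y hy1 hyb)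
      rw [hye]
    · exact absurd hy.eventF (hF _ hgy)

/-- The labelled version of `EventF` agrees with `EventF`. -/
theorem eventF_arrivalOfLabels {σ : Fin (Fintype.card Ω) ≃ Ω} {l : Ω → Fin (k + 2)} :
    EventF g f (arrivalOfLabels σ l) S i j ↔ LabelEventF g f l S i j := by
  simp only [EventF, LabelEventF, IsHighest, mem_inter, mem_groupSet,
    mem_arrivedBefore_arrivalOfLabels, mem_block_arrivalOfLabels, Nat.lt_succ_iff]
  refine exists_congr fun e => ⟨fun h => ⟨h.1.1.1, h.2, fun e' h1 h2 => h.1.2 e' ⟨h1, h2⟩⟩,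
    fun h => ⟨⟨⟨h.1, h.2.1.le⟩, fun e' h1 => h.2.2 e' h1.1 h1.2⟩, h.2.1⟩⟩

/-- Whether the candidate of epoch `t + 1` is kept. -/
def keeps (m : Mode) (c : Fin k → Bool) (t : ℕ) : Bool :=
  if h : t < k then m.accepts (c ⟨t, h⟩) else false

theorem selected_succ (ω : Arrival Ω k) (m : Mode) (c : Fin k → Bool) (j : ℕ) :
    selected g f ω m c (j + 1) =
      match candidate g f ω (selected g f ω m c j) (j + 1) with
      | none => selected g f ω m c j
      | some x => if keeps m c j then insert x (selected g f ω m c j)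
          else selected g f ω m c j := by
  rw [selected]
  by_cases h : j < k
  · simp only [h, dite_true, keeps]
  · simp only [h, dite_false, keeps]
    cases candidate g f ω (selected g f ω m c j) (j + 1) <;> simp

/-- The algorithm in terms of the labels. -/
theorem selected_arrivalOfLabels (σ : Fin (Fintype.card Ω) ≃ Ω) (l : Ω → Fin (k + 2)) (m : Mode)
    (c : Fin k → Bool) (j : ℕ) :
    selected g f (arrivalOfLabels σ l) m c j =
      maskedRun σ g f (keeps m c) (fun _ => False) l 0 ∅ j := by
  have hcand : ∀ S t, candidate g f (arrivalOfLabels σ l) S t =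
      maskedCandidate σ g f (fun _ => False) l S t := by
    intro S t
    have hq : Qualifies g f (arrivalOfLabels σ l) S t =
        fun e => ¬ False ∧ LabelQualifies g f l S t e := by
      funext e
      simp [Qualifies, LabelQualifies, mem_block_arrivalOfLabels,
        mem_arrivedBefore_arrivalOfLabels]
    rw [candidate_eq_firstSat, maskedCandidate, hq]
    exact firstSat_congr fun x y hx hy =>
      arrivalOfLabels_symm_le_iff σ l (Fin.ext (hx.2.1.trans hy.2.1.symm))
  induction j with
  | zero => rfl
  | succ j ih =>
    rw [maskedRun_succ, ← ih, selected_succ, maskedStep, zero_add, hcand]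

/-- The highest element of group `i` is in epoch `j`, and the second highest, if any, is in the
sample. -/
def TopEvent (g : Ω → Fin k) (f : Finset Ω → ℝ) (l : Ω → Fin (k + 2)) (S : Finset Ω) (i : Fin k)
    (j : ℕ) : Prop :=
  ∃ e, IsHighest f S (groupSet g i) e ∧ (l e : ℕ) = j ∧
    ∀ e', IsHighest f S ((groupSet g i).erase e) e' → l e' = 0

/-- Given the other groups, the highest and second highest element are fixed and their labels
independent. So `β` is `1/2`, or `1` for a group with a single element. It is one constant for all
`T` and `Y`, so main term and error terms share the factor. -/
theorem labelMean_topEvent_mul (hne : (groupSet g i).Nonempty) (h0 : j ≠ 0) (hk : j ≤ k) :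
    ∃ β : ℝ, 1 / 2 ≤ β ∧ ∀ (T : (Ω → Fin (k + 2)) → Finset Ω) (Y : (Ω → Fin (k + 2)) → ℝ),
      IndepOfGroup g i T → IndepOfGroup g i Y →
        labelMean (fun l => ind (TopEvent g f l (T l) i j) * Y l) =
          1 / (100 * (k : ℝ)) * β * labelMean Y := by
  let J : Fin (k + 2) := ⟨j, by omega⟩
  have hJ : labelProb k J = 1 / (100 * (k : ℝ)) := labelProb_epoch h0 hk
  choose hi hhi using fun S => exists_isHighest (f := f) (S := S) hne
  have hhg : ∀ S, g (hi S) = i := fun S => mem_groupSet.1 (hhi S).1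
  by_cases hcard : 1 < (groupSet g i).card
  · refine ⟨1 / 2, le_rfl, fun T Y hT hY => ?_⟩
    have herase : ∀ S, ((groupSet g i).erase (hi S)).Nonempty := fun S => by
      rw [← card_pos, card_erase_of_mem (hhi S).1]
      omega
    choose lo hlo using fun S => exists_isHighest (f := f) (S := S) (herase S)
    have hlg : ∀ S, g (lo S) = i := fun S => mem_groupSet.1 (mem_of_mem_erase (hlo S).1)
    have hiff : ∀ l, TopEvent g f l (T l) i j ↔ l (hi (T l)) = J ∧ l (lo (T l)) = 0 := by
      intro l
      constructor
      · rintro ⟨e, he, hej, h⟩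
        obtain rfl := he.unique (hhi (T l))
        exact ⟨Fin.ext hej, h _ (hlo _)⟩
      · rintro ⟨h1, h2⟩
        refine ⟨_, hhi _, by rw [h1], fun e' he' => ?_⟩
        rw [he'.unique (hlo _), h2]
    have h1 : labelMean (fun l => ind (TopEvent g f l (T l) i j) * Y l) =
        labelMean (fun l => ind (l (hi (T l)) = J) * (ind (l (lo (T l)) = 0) * Y l)) := by
      congr 1
      ext l
      rw [ind_congr (hiff l), ind_and, mul_assoc]
    rw [h1, labelMean_ind_apply_mul (fun l => hi (T l)) J, labelMean_ind_apply_mul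
      (fun l => lo (T l)) 0, hJ, labelProb_zero, mul_assoc]
    · intro l v; rw [hT.update (hlg _)]
    · intro l v; rw [hY.update (hlg _)]
    · intro l v; rw [hT.update (hhg _)]
    · intro l v
      rw [hY.update (hhg _), hT.update (hhg _), Function.update_of_ne (mem_erase.1 (hlo _).1).1]
  · refine ⟨1, by norm_num, fun T Y hT hY => ?_⟩
    have herase : ∀ S, (groupSet g i).erase (hi S) = ∅ := fun S => by
      rw [← card_eq_zero, card_erase_of_mem (hhi S).1]
      omega
    have hiff : ∀ l, TopEvent g f l (T l) i j ↔ l (hi (T l)) = J := by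
      intro l
      constructor
      · rintro ⟨e, he, hej, h⟩
        obtain rfl := he.unique (hhi (T l))
        exact Fin.ext hej
      · intro h1
        refine ⟨_, hhi _, by rw [h1], fun e' he' => ?_⟩
        rw [herase] at he'
        exact absurd he'.1 (notMem_empty _)
    simp only [fun l => ind_congr (hiff l)]
    rw [labelMean_ind_apply_mul (fun l => hi (T l)) J, hJ, mul_one]
    · intro l v; rw [hT.update (hhg _)]
    · intro l v; rw [hY.update (hhg _)]

/-- Moving an element from another epoch to the sample does not destroy `TopEvent`. -/
theorem TopEvent.update {T : (Ω → Fin (k + 2)) → Finset Ω} (hT : IndepOfGroup g i T)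
    {l : Ω → Fin (k + 2)} {y : Ω} (hy : g y = i) (hyj : (l y : ℕ) ≠ j)
    (h : TopEvent g f l (T l) i j) :
    TopEvent g f (Function.update l y 0) (T (Function.update l y 0)) i j := by
  obtain ⟨e, he, hej, h⟩ := h
  rw [hT.update hy]
  refine ⟨e, he, ?_, fun e' he' => ?_⟩
  · rw [Function.update_of_ne (by rintro rfl; exact hyj hej), hej]
  · by_cases h' : e' = y
    · rw [h', Function.update_self]
    · rw [Function.update_of_ne h', h e' he']

variable (σ : Fin (Fintype.card Ω) ≃ Ω) (a : ℕ → Bool)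

/-- If the top event happens for the run that ignores group `i`, and neither this group in earlier
epochs nor another group in this epoch interferes, then the good event happens. -/
theorem goodEvent_of_topEvent {l : Ω → Fin (k + 2)}
    (h1 : TopEvent g f l (maskedRun σ g f a (fun x => False ∨ x = i) l 0 ∅ j) i (j + 1))
    (h2 : ∀ i' ≠ i, ¬ LabelEventF g f l
      (maskedRun σ g f a (fun x => False ∨ x = i) l 0 ∅ j) i' (j + 1)) :
    GoodEvent g f (arrivalOfLabels σ l)
      (maskedRun σ g f a (fun x => False ∨ x = i) l 0 ∅ j) i (j + 1) := by
  obtain ⟨e, he, hej, h⟩ := h1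
  refine ⟨⟨⟨e, he, (mem_block_arrivalOfLabels σ l e _).2 hej⟩, fun e1 e2 he1 he2 => ?_, ?_⟩,
    fun i' hi' => fun hF => h2 i' hi' (eventF_arrivalOfLabels.1 hF)⟩
  · rw [mem_arrivedBefore_arrivalOfLabels, h e2 (he.unique he1 ▸ he2)]
    simp
  · rintro ⟨s, hs, hsi⟩
    exact not_mask_of_mem_maskedRun (by simp) s hs (Or.inr hsi)

/-- Lower bound for the good event, weighted with a bounded nonnegative function of the current
set. -/
theorem le_labelMean_mul_goodEvent (hne : (groupSet g i).Nonempty) (hj : j < k)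
    (Y : Finset Ω → ℝ) (y : ℝ) (hY0 : ∀ S, 0 ≤ Y S) (hY : ∀ S, Y S ≤ y) :
    1 / (200 * (k : ℝ)) *
        (labelMean (fun l => Y (maskedRun σ g f a (fun _ => False) l 0 ∅ j)) - 7 / 100 * y) ≤
      labelMean (fun l => Y (maskedRun σ g f a (fun _ => False) l 0 ∅ j) *
        ind (GoodEvent g f (arrivalOfLabels σ l)
          (maskedRun σ g f a (fun _ => False) l 0 ∅ j) i (j + 1))) := by
  set R : (Ω → Fin (k + 2)) → Finset Ω := fun l => maskedRun σ g f a (fun _ => False) l 0 ∅ j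
  set R' : ℕ → (Ω → Fin (k + 2)) → Finset Ω := fun t l =>
    maskedRun σ g f a (fun x => False ∨ x = i) l 0 ∅ t with hR'
  have hindep : ∀ t, IndepOfGroup g i (R' t) := fun t =>
    IndepOfGroup.run (T := fun _ => ∅) (fun _ _ _ => rfl) (Or.inr rfl) 0 t
  set F : ℕ → (Ω → Fin (k + 2)) → ℝ := fun t l => ind (LabelEventF g f l (R' t l) i (t + 1)) with hF
  set F' : Fin k → (Ω → Fin (k + 2)) → ℝ := fun i' l =>
    ind (LabelEventF g f l (R' j l) i' (j + 1)) with hF'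
  set Q : (Ω → Fin (k + 2)) → ℝ := fun l => ind (TopEvent g f l (R' j l) i (j + 1)) with hQ
  have hy0 : 0 ≤ y := (hY0 ∅).trans (hY ∅)
  have hFn : ∀ l, 0 ≤ ∑ t ∈ range j, F t l := fun l => sum_nonneg fun _ _ => ind_nonneg _
  have hFn' : ∀ l, 0 ≤ ∑ i' ∈ univ.erase i, F' i' l := fun l => sum_nonneg fun _ _ => ind_nonneg _
  have hrun : ∀ l, (∀ t < j, ¬ LabelEventF g f l (R' t l) i (t + 1)) → R l = R' j l :=
    fun l h => maskedRun_eq_of_not_labelEventF h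
  have hk0 : 0 < k := by omega
  have hkpos : (0 : ℝ) < k := by exact_mod_cast hk0
  set r : ℝ := 1 / (50 * (k : ℝ)) with hr
  have hr0 : 0 < r := by positivity
  have hrk : r * k = 1 / 50 := by rw [hr]; field_simp
  have hjk : (j : ℝ) ≤ k := by exact_mod_cast hj.le
  have hjr : j * r ≤ 1 / 50 := by nlinarith
  obtain ⟨β, hβ, hmean⟩ := labelMean_topEvent_mul (f := f) hne (Nat.succ_ne_zero j) hj
  set p : ℝ := 1 / (100 * (k : ℝ)) with hp
  have hp0 : 0 < p := by positivity
  -- the run with group `i` ignored against the actual run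
  have hA : ∀ t ∈ range j, labelMean (F t) ≤ r := by
    intro t ht
    have h := labelMean_labelEventF_mul_le (f := f) (hindep t) (t := t + 1) (by omega)
      (by have := mem_range.1 ht; omega) (fun _ => 1) (fun _ => zero_le_one) (fun _ _ _ _ => le_rfl)
    simpa only [mul_one, labelMean_const] using h
  -- The two runs differ only if group `i` interferes in one of the `j ≤ k` earlier epochs.
  have h1 : labelMean (fun l => Y (R l)) - y * (1 / 50) ≤ labelMean (fun l => Y (R' j l)) := by
    have h : labelMean (fun l => Y (R l) - y * ∑ t ∈ range j, F t l) ≤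
        labelMean (fun l => Y (R' j l)) := by
      refine labelMean_mono fun l => ?_
      by_cases hc : ∀ t < j, ¬ LabelEventF g f l (R' t l) i (t + 1)
      · rw [hrun l hc]
        have := mul_nonneg hy0 (hFn l)
        linarith
      · push Not at hc
        obtain ⟨t, ht, hFt⟩ := hc
        have h3 : 1 ≤ ∑ t ∈ range j, F t l := by
          rw [← ind_of hFt]
          exact single_le_sum (f := fun t => F t l) (fun _ _ => ind_nonneg _) (mem_range.2 ht)
        have := hY (R l)
        have := hY0 (R' j l)
        nlinarith
    rw [labelMean_sub, labelMean_const_mul, labelMean_sum] at h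
    have h4 := sum_le_sum hA
    rw [sum_const, card_range, nsmul_eq_mul] at h4
    have := mul_le_mul_of_nonneg_left (h4.trans hjr) hy0
    linarith
  -- interference by group `i` in earlier epochs
  have h2 : ∀ t ∈ range j, labelMean (fun l => F t l * Q l) ≤ r * (p * β) := by
    intro t ht
    rw [mem_range] at ht
    have h := labelMean_labelEventF_mul_le (f := f) (hindep t) (t := t + 1) (by omega)
      (by omega) Q (fun _ => ind_nonneg _) (fun l y hy hyt => ind_mono fun hT =>
        TopEvent.update (hindep j) hy (by omega) hT)
    have h3 := hmean (R' j) (fun _ => 1) (hindep j) (fun _ _ _ => rfl)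
    simp only [mul_one, labelMean_const] at h3
    rwa [h3] at h
  -- interference by the other groups
  have h3 : ∀ i' ∈ univ.erase i, labelMean (fun l => F' i' l * Q l) ≤
      p * β * (r + j * (2 * r ^ 2)) := by
    intro i' hi'
    have hii : i' ≠ i := ne_of_mem_erase hi'
    have hFi : IndepOfGroup g i (F' i') := by
      intro l l' hl
      simp only [hF', LabelEventF, (hindep j) l l' hl]
      refine ind_congr (exists_congr fun e => and_congr_right fun he => ?_)
      rw [hl e (he ▸ hii)]
      refine and_congr_right fun _ => forall_congr' fun e' => forall_congr' fun he' => ?_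
      rw [hl e' (he' ▸ hii)]
    have h := hmean (R' j) (F' i') (hindep j) hFi
    simp only [mul_comm (F' i' _)]
    rw [h]
    have h5 := labelMean_labelEventF_maskedRun_le (σ := σ) (g := g) (f := f) (a := a)
      (M := fun x => False ∨ x = i) (i := i') j (t := 0) (by omega)
      (T := fun _ => ∅) (fun _ _ _ => rfl)
    rw [zero_add] at h5
    exact mul_le_mul_of_nonneg_left h5 (by positivity)
  -- A union bound, pointwise: on the top event each interference subtracts `y`, which is at least
  -- the weight lost; without interference the runs agree and the good event holds.
  have h4 : labelMean (fun l => Q l * Y (R' j l)) -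
      y * (labelMean (fun l => ∑ t ∈ range j, F t l * Q l) +
        labelMean (fun l => ∑ i' ∈ univ.erase i, F' i' l * Q l)) ≤
      labelMean (fun l => Y (R l) * ind (GoodEvent g f (arrivalOfLabels σ l) (R l) i (j + 1))) := by
    rw [← labelMean_add, ← labelMean_const_mul, ← labelMean_sub]
    refine labelMean_mono fun l => ?_
    simp only [← sum_mul, ← add_mul]
    have hG : 0 ≤ Y (R l) * ind (GoodEvent g f (arrivalOfLabels σ l) (R l) i (j + 1)) :=
      mul_nonneg (hY0 _) (ind_nonneg _)
    by_cases hTop : TopEvent g f l (R' j l) i (j + 1)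
    · have hQ1 : Q l = 1 := ind_of hTop
      rw [hQ1, one_mul, mul_one]
      have hYl := hY (R' j l)
      have e1 := hFn l
      have e2 := hFn' l
      by_cases hc : ∀ t < j, ¬ LabelEventF g f l (R' t l) i (t + 1)
      · by_cases hc' : ∀ i' ≠ i, ¬ LabelEventF g f l (R' j l) i' (j + 1)
        · have hgood := goodEvent_of_topEvent σ a hTop hc'
          rw [hrun l hc, ind_of hgood]
          have := mul_nonneg hy0 (add_nonneg e1 e2)
          linarith
        · push Not at hc'
          obtain ⟨i', hi', hFi⟩ := hc'
          have h5 : 1 ≤ ∑ i' ∈ univ.erase i, F' i' l := by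
            rw [← ind_of hFi]
            exact single_le_sum (f := fun t => F' t l) (fun _ _ => ind_nonneg _)
              (mem_erase.2 ⟨hi', mem_univ _⟩)
          nlinarith
      · push Not at hc
        obtain ⟨t, ht, hFt⟩ := hc
        have h5 : 1 ≤ ∑ t ∈ range j, F t l := by
          rw [← ind_of hFt]
          exact single_le_sum (f := fun t => F t l) (fun _ _ => ind_nonneg _) (mem_range.2 ht)
        nlinarith
    · have hQ0 : Q l = 0 := ind_of_not hTop
      rw [hQ0]
      simpa using hG
  rw [hmean (R' j) (fun l => Y (R' j l)) (hindep j) ((hindep j).comp Y), labelMean_sum,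
    labelMean_sum] at h4
  have h5 := sum_le_sum h2
  have h6 := sum_le_sum h3
  rw [sum_const, card_range, nsmul_eq_mul] at h5
  rw [sum_const, card_erase_of_mem (mem_univ i), card_univ, Fintype.card_fin, nsmul_eq_mul] at h6
  have hpβ : 0 < p * β := by positivity
  have h5' : ∑ t ∈ range j, labelMean (fun l => F t l * Q l) ≤ p * β * (1 / 50) := by
    refine h5.trans ?_
    have := mul_le_mul_of_nonneg_left hjr hpβ.le
    linarith
  -- With fewer than `k` other groups the factor is at most `k * r * (1 + 2 * j * r) ≤ (1/50) *
  -- (26/25)`.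
  have h6' : ∑ i' ∈ univ.erase i, labelMean (fun l => F' i' l * Q l) ≤ p * β * (3 / 100) := by
    refine h6.trans ?_
    have e1 : ((k - 1 : ℕ) : ℝ) ≤ k := by exact_mod_cast Nat.sub_le k 1
    have e2 : r + j * (2 * r ^ 2) ≤ r * (26 / 25) := by nlinarith
    have e3 : 0 ≤ r + j * (2 * r ^ 2) := by positivity
    have e4 : ((k - 1 : ℕ) : ℝ) * (r + j * (2 * r ^ 2)) ≤ 3 / 100 := by
      calc ((k - 1 : ℕ) : ℝ) * (r + j * (2 * r ^ 2)) ≤ k * (r * (26 / 25)) :=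
            mul_le_mul e1 e2 e3 hkpos.le
        _ = r * k * (26 / 25) := by ring
        _ ≤ 3 / 100 := by rw [hrk]; norm_num
    have := mul_le_mul_of_nonneg_left e4 hpβ.le
    linarith
  have h7 := mul_le_mul_of_nonneg_left (add_le_add h5' h6') hy0
  have h8 := mul_le_mul_of_nonneg_left h1 hpβ.le
  have hLM : 0 ≤ labelMean (fun l => Y (R l) *
      ind (GoodEvent g f (arrivalOfLabels σ l) (R l) i (j + 1))) :=
    labelMean_nonneg fun l => mul_nonneg (hY0 _) (ind_nonneg _)
  -- The losses are `1/50` for replacing the run, `1/50` for group `i` and `3/100` for the others.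
  have h9 : p * β * (labelMean (fun l => Y (R l)) - 7 / 100 * y) ≤ labelMean (fun l => Y (R l) *
      ind (GoodEvent g f (arrivalOfLabels σ l) (R l) i (j + 1))) := by
    linarith
  have hp2 : 1 / (200 * (k : ℝ)) = p * (1 / 2) := by rw [hp]; field_simp; norm_num
  rw [hp2]
  -- Replacing `β` by `1/2` needs a nonnegative bracket; otherwise the bound is trivial.
  rcases le_total 0 (labelMean (fun l => Y (R l)) - 7 / 100 * y) with hz | hz
  · exact (mul_le_mul_of_nonneg_right (mul_le_mul_of_nonneg_left hβ hp0.le) hz).trans h9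
  · exact (mul_nonpos_of_nonneg_of_nonpos (by positivity) hz).trans hLM

end Good

/-! Fair coins. -/

section Coins

variable {ι : Type*} [Fintype ι] [DecidableEq ι]

/-- Expectation over independent fair coins. -/
noncomputable def coinMean (X : (ι → Bool) → ℝ) : ℝ := (1 / 2) ^ Fintype.card ι * ∑ b, X b

/-- The outcome in which the coins in `s` are turned over. -/
def flipOn (s : Finset ι) (b : ι → Bool) : ι → Bool := fun e => if e ∈ s then !b e else b e

theorem coinMean_flipOn (s : Finset ι) (X : (ι → Bool) → ℝ) :
    coinMean (fun b => X (flipOn s b)) = coinMean X := by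
  have h : Function.Involutive (flipOn s) := by
    intro b
    ext e
    by_cases he : e ∈ s <;> simp [flipOn, he]
  rw [coinMean, coinMean]
  congr 1
  exact Fintype.sum_equiv h.toPerm _ _ fun _ => rfl

theorem coinMean_mono {X Y : (ι → Bool) → ℝ} (h : ∀ b, X b ≤ Y b) : coinMean X ≤ coinMean Y :=
  mul_le_mul_of_nonneg_left (sum_le_sum fun b _ => h b) (by positivity)

theorem coinMean_const (a : ℝ) : coinMean (fun _ : ι → Bool => a) = a := by
  rw [coinMean, sum_const, card_univ, Fintype.card_fun, Fintype.card_bool, nsmul_eq_mul,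
    ← mul_assoc]
  push_cast
  rw [← mul_pow]
  norm_num

theorem coinMean_add (X Y : (ι → Bool) → ℝ) :
    coinMean (fun b => X b + Y b) = coinMean X + coinMean Y := by
  simp only [coinMean, sum_add_distrib, mul_add]

theorem coinMean_sub (X Y : (ι → Bool) → ℝ) :
    coinMean (fun b => X b - Y b) = coinMean X - coinMean Y := by
  simp only [coinMean, sum_sub_distrib, mul_sub]

theorem coinMean_const_mul (a : ℝ) (X : (ι → Bool) → ℝ) :
    coinMean (fun b => a * X b) = a * coinMean X := by
  simp only [coinMean, ← mul_sum]
  ring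

theorem coinMean_sum {κ : Type*} (s : Finset κ) (X : κ → (ι → Bool) → ℝ) :
    coinMean (fun b => ∑ x ∈ s, X x b) = ∑ x ∈ s, coinMean (X x) := by
  simp only [coinMean, ← mul_sum]
  rw [sum_comm]

end Coins

/-! Expectations over all the randomness. -/

section Expectation

variable {Ω : Type u} [Fintype Ω] [LinearOrder Ω] {k : ℕ}

theorem arrivalWeight_nonneg (ω : Arrival Ω k) : 0 ≤ arrivalWeight ω :=
  mul_nonneg (by positivity) (prod_nonneg fun _ _ => labelProb_nonneg k _)

theorem arrivalMean_mono {X Y : Arrival Ω k → ℝ} (h : ∀ ω, X ω ≤ Y ω) :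
    arrivalMean X ≤ arrivalMean Y :=
  sum_le_sum fun ω _ => mul_le_mul_of_nonneg_left (h ω) (arrivalWeight_nonneg ω)

theorem arrivalMean_add (X Y : Arrival Ω k → ℝ) :
    arrivalMean (fun ω => X ω + Y ω) = arrivalMean X + arrivalMean Y := by
  simp only [arrivalMean, mul_add, sum_add_distrib]

theorem arrivalMean_sub (X Y : Arrival Ω k → ℝ) :
    arrivalMean (fun ω => X ω - Y ω) = arrivalMean X - arrivalMean Y := by
  simp only [arrivalMean, mul_sub, sum_sub_distrib]

theorem arrivalMean_const_mul (a : ℝ) (X : Arrival Ω k → ℝ) :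
    arrivalMean (fun ω => a * X ω) = a * arrivalMean X := by
  simp only [arrivalMean, mul_sum]
  exact sum_congr rfl fun ω _ => by ring

theorem arrivalMean_sum {ι : Type*} (s : Finset ι) (X : ι → Arrival Ω k → ℝ) :
    arrivalMean (fun ω => ∑ x ∈ s, X x ω) = ∑ x ∈ s, arrivalMean (X x) := by
  simp only [arrivalMean, mul_sum]
  exact sum_comm

theorem expectation_eq (X : Outcome Ω k → ℝ) :
    expectation X = 1 / 3 * ∑ m, coinMean (fun c => arrivalMean (fun ω =>
      coinMean (fun keep => X (ω, m, c, keep)))) := by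
  simp only [expectation, outcomeWeight, arrivalMean, coinMean, mul_sum, Fintype.card_fin]
  rw [Fintype.sum_prod_type, sum_comm, Fintype.sum_prod_type]
  refine sum_congr rfl fun m _ => ?_
  rw [Fintype.sum_prod_type]
  refine sum_congr rfl fun c _ => ?_
  rw [sum_comm]
  refine sum_congr rfl fun ω _ => ?_
  refine sum_congr rfl fun keep _ => ?_
  ring

theorem prob_eq_expectation (E : Outcome Ω k → Prop) :
    prob E = expectation (fun o => ind (E o)) := by
  simp only [prob, expectation, ind]
  exact sum_congr rfl fun ω _ => by split_ifs <;> simp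

end Expectation

/-! ### Selection probabilities, the role of the coins, and independence of the output. -/

section Selected

variable {Ω : Type u} [Fintype Ω] [LinearOrder Ω] {k : ℕ} {g : Ω → Fin k} {f : Finset Ω → ℝ}
  {ω : Arrival Ω k} {m m' : Mode} {c c' : Fin k → Bool} {i j : Fin k}

theorem le_arrivalMean_mul_goodEvent (hne : (groupSet g i).Nonempty) (j : Fin k) (m : Mode)
    (c : Fin k → Bool) (Y : Finset Ω → ℝ) (y : ℝ) (hY0 : ∀ S, 0 ≤ Y S) (hY : ∀ S, Y S ≤ y) :
    1 / (200 * (k : ℝ)) *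
        (arrivalMean (fun ω => Y (selected g f ω m c j)) - 7 / 100 * y) ≤
      arrivalMean (fun ω => Y (selected g f ω m c j) *
        ind (GoodEvent g f ω (selected g f ω m c j) i (j + 1))) := by
  rw [← arrivalMean_const (Ω := Ω) (k := k) (7 / 100 * y), ← arrivalMean_sub,
    ← arrivalMean_const_mul]
  refine arrivalMean_le_of_labelMean_le fun σ => ?_
  simp only [selected_arrivalOfLabels]
  rw [labelMean_const_mul, labelMean_sub, labelMean_const]
  exact le_labelMean_mul_goodEvent σ (keeps m c) hne j.2 Y y hY0 hY

theorem le_arrivalProb_goodEvent (hne : (groupSet g i).Nonempty) (j : Fin k) (m : Mode)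
    (c : Fin k → Bool) :
    37 / (16000 * (k : ℝ)) ≤
      arrivalProb (fun ω => GoodEvent g f ω (selected g f ω m c j) i (j + 1)) := by
  have h := le_arrivalMean_mul_goodEvent (f := f) hne j m c (fun _ => 1) 1
    (fun _ => zero_le_one) fun _ => le_rfl
  simp only [arrivalMean_const, one_mul] at h
  rw [arrivalProb_eq_arrivalMean]
  refine le_trans ?_ h
  have hk : (0 : ℝ) < k := by exact_mod_cast (Fin.pos j)
  -- The estimate gives `93/(20000k)`, about twice what is needed.
  rw [div_mul_eq_mul_div, div_le_div_iff₀ (by positivity) (by positivity)]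
  nlinarith

theorem le_arrivalProb_candidate (hne : (groupSet g i).Nonempty) (j : Fin k) (m : Mode)
    (c : Fin k → Bool) :
    37 / (16000 * (k : ℝ)) ≤
      arrivalProb (fun ω => ∃ e, IsHighest f (selected g f ω m c j) (groupSet g i) e ∧
        candidate g f ω (selected g f ω m c j) (j + 1) = some e) := by
  refine (le_arrivalProb_goodEvent (f := f) hne j m c).trans ?_
  rw [arrivalProb_eq_arrivalMean, arrivalProb_eq_arrivalMean]
  exact arrivalMean_mono fun ω => ind_mono fun h => h.candidate_eq

/-- The set selected before an epoch depends on the previous coins only. -/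
theorem selected_congr {j : ℕ} (h : ∀ t < j, keeps m c t = keeps m' c' t) :
    selected g f ω m c j = selected g f ω m' c' j := by
  induction j with
  | zero => rfl
  | succ j ih =>
    rw [selected_succ, selected_succ, ih fun t ht => h t (ht.trans j.lt_succ_self),
      h j j.lt_succ_self]

theorem keeps_flipOn_of_ne {t : ℕ} (h : t ≠ j) : keeps m (flipOn {j} c) t = keeps m c t := by
  unfold keeps
  split_ifs with ht
  · rw [flipOn, if_neg]
    rw [mem_singleton]
    rintro rfl
    exact h rfl
  · rfl

theorem keeps_flipOn_self {s : Finset (Fin k)} (h : j ∈ s) :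
    keeps m (flipOn s c) j = !keeps m c j := by
  unfold keeps
  simp only [j.2, dite_true, Fin.eta, flipOn, h, if_true]
  cases m <;> rfl

theorem selected_flipOn : selected g f ω m (flipOn {j} c) j = selected g f ω m c j :=
  selected_congr fun _ ht => keeps_flipOn_of_ne ht.ne

theorem qualifies_of_candidate_eq_some {S : Finset Ω} {t : ℕ} {x : Ω}
    (h : candidate g f ω S t = some x) : Qualifies g f ω S t x :=
  (firstSat_eq_some.1 (candidate_eq_firstSat (g := g) (f := f) ω ▸ h)).1

theorem notMem_of_candidate_eq_some {S : Finset Ω} {t : ℕ} {x : Ω}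
    (h : candidate g f ω S t = some x) : x ∉ S := fun hx =>
  (qualifies_of_candidate_eq_some h).2.1 x hx rfl

/-- A coin that does not influence `X` halves its expectation. -/
theorem coinMean_keeps (X : (Fin k → Bool) → ℝ) (hX : ∀ c, X (flipOn {j} c) = X c) :
    coinMean (fun c => if keeps m c j then X c else 0) = 1 / 2 * coinMean X := by
  have h := coinMean_flipOn {j} (fun c => if keeps m c j then X c else 0)
  have h2 : coinMean (fun c => (if keeps m c j then X c else 0) +
      (if keeps m (flipOn {j} c) j then X (flipOn {j} c) else 0)) = coinMean X := by
    congr 1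
    ext c
    rw [keeps_flipOn_self (mem_singleton_self j), hX]
    cases keeps m c j <;> simp
  rw [coinMean_add] at h2
  linarith

theorem le_prob_selected (hne : (groupSet g i).Nonempty) (j : Fin k) :
    37 / (32000 * (k : ℝ)) ≤
      prob (fun o : Outcome Ω k => ∃ e,
        IsHighest f (selected g f o.1 o.2.1 o.2.2.1 j) (groupSet g i) e ∧
          e ∉ selected g f o.1 o.2.1 o.2.2.1 j ∧
          e ∈ selected g f o.1 o.2.1 o.2.2.1 (j + 1)) := by
  have hm : ∀ m : Mode, 37 / (32000 * (k : ℝ)) ≤ coinMean (fun c => arrivalMean (fun ω =>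
      ind (∃ e, IsHighest f (selected g f ω m c j) (groupSet g i) e ∧
          e ∉ selected g f ω m c j ∧ e ∈ selected g f ω m c (j + 1)))) := by
    intro m
    let X : (Fin k → Bool) → ℝ := fun c => arrivalMean (fun ω =>
      ind (∃ e, IsHighest f (selected g f ω m c j) (groupSet g i) e ∧
        candidate g f ω (selected g f ω m c j) (j + 1) = some e))
    have hX : ∀ c, X (flipOn {j} c) = X c := fun c => by simp only [X, selected_flipOn]
    have h1 : 37 / (16000 * (k : ℝ)) ≤ coinMean X := by
      rw [← coinMean_const (ι := Fin k) (37 / (16000 * (k : ℝ)))]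
      refine coinMean_mono fun c => ?_
      simp only [X]
      rw [← arrivalProb_eq_arrivalMean]
      exact le_arrivalProb_candidate hne j m c
    have h2 := coinMean_keeps (m := m) X hX
    calc 37 / (32000 * (k : ℝ)) = 1 / 2 * (37 / (16000 * (k : ℝ))) := by ring
      _ ≤ 1 / 2 * coinMean X := by linarith
      _ = _ := h2.symm
      _ ≤ _ := coinMean_mono fun c => ?_
    split_ifs with hc
    · refine arrivalMean_mono fun ω => ind_mono ?_
      rintro ⟨e, he, hcand⟩
      refine ⟨e, he, notMem_of_candidate_eq_some hcand, ?_⟩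
      rw [selected_succ, hcand]
      simp [hc]
    · rw [← arrivalMean_const (Ω := Ω) (k := k) 0]
      exact arrivalMean_mono fun ω => ind_nonneg _
  rw [prob_eq_expectation, expectation_eq]
  simp only [coinMean_const]
  have h := sum_le_sum fun m (_ : m ∈ univ) => hm m
  rw [sum_const, card_univ, show Fintype.card Mode = 3 from rfl, nsmul_eq_mul] at h
  push_cast at h
  linarith

theorem partitionIndep_selected (t : ℕ) : PartitionIndep g (selected g f ω m c t) := by
  induction t with
  | zero => intro i; simp [selected]
  | succ t ih =>
    rw [selected_succ]
    cases h : candidate g f ω (selected g f ω m c t) (t + 1) with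
    | none => exact ih
    | some x =>
      cases keeps m c t with
      | false => exact ih
      | true =>
        intro i
        simp only [if_true]
        have hq := (qualifies_of_candidate_eq_some h).2.1
        by_cases hx : g x = i
        · rw [filter_insert, if_pos hx, filter_false_of_mem fun s hs => hx ▸ hq s hs]
          simp
        · rw [filter_insert, if_neg hx]
          exact ih i

theorem partitionIndep_output (o : Outcome Ω k) : PartitionIndep g (output g f o) := by
  obtain ⟨ω, m, c, keep⟩ := o
  cases m with
  | A => exact partitionIndep_selected _
  | C => exact partitionIndep_selected _
  | B =>
    exact fun i => (card_le_card (filter_subset_filter _ (filter_subset _ _))).trans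
      (partitionIndep_selected _ i)

/-- Every selected element arrived in an epoch whose coin showed the right side. -/
theorem exists_block_of_mem_selected {t : ℕ} {x : Ω} (hx : x ∈ selected g f ω m c t) :
    ∃ s, keeps m c s = true ∧ x ∈ block ω (s + 1) := by
  induction t with
  | zero => simp [selected] at hx
  | succ t ih =>
    rw [selected_succ] at hx
    cases h : candidate g f ω (selected g f ω m c t) (t + 1) with
    | none => rw [h] at hx; exact ih hx
    | some y =>
      rw [h] at hx
      cases hk : keeps m c t with
      | false => simp only [hk] at hx; exact ih hx
      | true =>
        simp only [hk, if_true, mem_insert] at hx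
        rcases hx with rfl | hx
        · exact ⟨t, hk, (qualifies_of_candidate_eq_some h).1⟩
        · exact ih hx

theorem blockStart_mono (ω : Arrival Ω k) : Monotone (blockStart ω) := fun _ _ hab =>
  sum_le_sum_of_subset (range_mono hab)

theorem eq_of_mem_block {s t : ℕ} {x : Ω} (hs : x ∈ block ω s) (ht : x ∈ block ω t) : s = t := by
  simp only [block, mem_filter, mem_univ, true_and] at hs ht
  rcases lt_trichotomy s t with h | h | h
  · have := blockStart_mono ω (Nat.succ_le_of_lt h)
    simp only [Nat.succ_eq_add_one] at this
    omega
  · exact h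
  · have := blockStart_mono ω (Nat.succ_le_of_lt h)
    simp only [Nat.succ_eq_add_one] at this
    omega

/-- With all coins turned over, the selected set is disjoint from the original one. -/
theorem selected_inter_selected_flipOn_univ (t : ℕ) :
    selected g f ω m c t ∩ selected g f ω m (flipOn univ c) t = ∅ := by
  refine eq_empty_of_forall_notMem fun x hx => ?_
  rw [mem_inter] at hx
  obtain ⟨s, hs, hxs⟩ := exists_block_of_mem_selected hx.1
  obtain ⟨s', hs', hxs'⟩ := exists_block_of_mem_selected hx.2
  -- An element arrives in only one epoch, and that epoch's candidate is kept under just one of the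
  -- two coin outcomes.
  obtain rfl : s = s' := by have := eq_of_mem_block hxs hxs'; omega
  by_cases h : s < k
  · have := keeps_flipOn_self (m := m) (c := c) (j := ⟨s, h⟩) (mem_univ _)
    simp only [hs, hs'] at this
    exact absurd this (by simp)
  · simp [keeps, h] at hs

end Selected

/-! Submodular functions. -/

section Submodular

variable {Ω : Type u} [LinearOrder Ω] {f : Finset Ω → ℝ}

/-- The positive part of the marginal value of an element. -/
noncomputable def gain (f : Finset Ω → ℝ) (S : Finset Ω) (x : Ω) : ℝ := max 0 (marginal f S {x})

theorem gain_nonneg (S : Finset Ω) (x : Ω) : 0 ≤ gain f S x := le_max_left _ _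

theorem marginal_le_gain (S : Finset Ω) (x : Ω) : marginal f S {x} ≤ gain f S x :=
  le_max_right _ _

theorem marginal_singleton (S : Finset Ω) (x : Ω) : marginal f S {x} = f (insert x S) - f S := by
  rw [marginal, union_comm, insert_eq]

theorem IsSubmodular.marginal_anti (hf : IsSubmodular f) {A B : Finset Ω} (h : A ⊆ B) {x : Ω}
    (hx : x ∉ B) : marginal f B {x} ≤ marginal f A {x} := by
  rw [marginal_singleton, marginal_singleton]
  have h1 := hf (insert x A) B
  rw [insert_union, union_eq_right.2 h, insert_inter_of_notMem hx, inter_eq_left.2 h] at h1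
  linarith

/-- Truncation at `0` removes the condition `x ∉ B` of `marginal_anti`: inside `B` the gain is `0`.
-/
theorem IsSubmodular.gain_anti (hf : IsSubmodular f) {A B : Finset Ω} (h : A ⊆ B) (x : Ω) :
    gain f B x ≤ gain f A x := by
  by_cases hx : x ∈ B
  · have : marginal f B {x} = 0 := by rw [marginal_singleton, insert_eq_of_mem hx, sub_self]
    rw [gain, this, max_self]
    exact gain_nonneg A x
  · exact max_le_max le_rfl (hf.marginal_anti h hx)

/-- Adding the elements of `T` to `S` one by one, in increasing order. -/
theorem sum_marginal_filter_lt (f : Finset Ω → ℝ) (S T : Finset Ω) :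
    ∑ t ∈ T, marginal f (S ∪ T.filter (· < t)) {t} = f (S ∪ T) - f S := by
  induction T using Finset.induction_on_max with
  | empty => simp
  | insert a T ha ih =>
    have hn : a ∉ T := fun h => lt_irrefl a (ha a h)
    have h1 : (insert a T).filter (· < a) = T := by
      rw [filter_insert, if_neg (lt_irrefl a), filter_true_of_mem ha]
    have h2 : ∀ t ∈ T, (insert a T).filter (· < t) = T.filter (· < t) := fun t ht => by
      rw [filter_insert, if_neg (ha t ht).not_gt]
    rw [sum_insert hn, h1, sum_congr rfl fun t ht => by rw [h2 t ht], ih, marginal_singleton,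
      union_insert]
    ring

/-- A random half of `S` is worth at least a quarter of any subset of `S`. -/
theorem IsSubmodular.le_four_mul_coinMean [Fintype Ω] (hf : IsSubmodular f) (h0 : ∀ S, 0 ≤ f S)
    {A S : Finset Ω} (hA : A ⊆ S) :
    f A ≤ 4 * coinMean (fun b : Ω → Bool => f (S.filter (fun e => b e = true))) := by
  set X : (Ω → Bool) → ℝ := fun b => f (S.filter (fun e => b e = true)) with hX
  -- Turning coins over on `A`, off `A`, or everywhere gives random halves with the same law. Two of
  -- the four halves have union `A` plus the original half, the other two have union `A` plus the
  -- complementary half, and these unions meet in `A`. Submodularity and nonnegativity then bound `f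
  -- A` by the sum of the four values.
  have h1 := coinMean_flipOn A X
  have h2 := coinMean_flipOn Aᶜ X
  have h3 := coinMean_flipOn univ X
  have h4 : f A ≤ coinMean (fun b => (X b + X (flipOn A b)) + (X (flipOn Aᶜ b) +
      X (flipOn univ b))) := by
    rw [← coinMean_const (ι := Ω) (f A)]
    refine coinMean_mono fun b => ?_
    set P := A ∪ S.filter (fun e => b e = true)
    set P' := A ∪ S.filter (fun e => b e = false)
    have e1 : S.filter (fun e => b e = true) ∪ S.filter (fun e => flipOn A b e = true) = P := by
      ext e
      have := @hA e
      by_cases he : e ∈ A <;> cases hb : b e <;> simp_all [flipOn, P]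
    have e2 : S.filter (fun e => flipOn Aᶜ b e = true) ∪
        S.filter (fun e => flipOn univ b e = true) = P' := by
      ext e
      have := @hA e
      by_cases he : e ∈ A <;> cases hb : b e <;> simp_all [flipOn, P']
    have e3 : P ∩ P' = A := by
      ext e
      have := @hA e
      by_cases he : e ∈ A <;> cases hb : b e <;> simp_all [P, P']
    have g1 := hf (S.filter (fun e => b e = true)) (S.filter (fun e => flipOn A b e = true))
    have g2 := hf (S.filter (fun e => flipOn Aᶜ b e = true))
      (S.filter (fun e => flipOn univ b e = true))
    have g3 := hf P P'
    rw [e1] at g1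
    rw [e2] at g2
    rw [e3] at g3
    have n1 := h0 (S.filter (fun e => b e = true) ∩ S.filter (fun e => flipOn A b e = true))
    have n2 := h0 (S.filter (fun e => flipOn Aᶜ b e = true) ∩
      S.filter (fun e => flipOn univ b e = true))
    have n3 := h0 (P ∪ P')
    simp only [hX]
    linarith
  rw [coinMean_add, coinMean_add, coinMean_add, h1, h2, h3] at h4
  linarith

end Submodular

/-! The value of the algorithm. -/

section Value

variable {Ω : Type u} [Fintype Ω] [LinearOrder Ω] {k : ℕ} {g : Ω → Fin k} {f : Finset Ω → ℝ}
  {ω : Arrival Ω k} {m : Mode} {c : Fin k → Bool}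

/-- The positive part of the marginal value of the candidate, `0` if there is none. -/
noncomputable def candidateGain (g : Ω → Fin k) (f : Finset Ω → ℝ) (ω : Arrival Ω k)
    (S : Finset Ω) (j : ℕ) : ℝ :=
  match candidate g f ω S j with
  | none => 0
  | some x => gain f S x

theorem candidateGain_nonneg (S : Finset Ω) (j : ℕ) : 0 ≤ candidateGain g f ω S j := by
  unfold candidateGain
  split
  · exact le_rfl
  · exact gain_nonneg _ _

/-- The sum of the positive marginal values of the elements selected in the first `t` epochs. -/
noncomputable def totalGain (g : Ω → Fin k) (f : Finset Ω → ℝ) (m : Mode) (c : Fin k → Bool)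
    (ω : Arrival Ω k) (t : ℕ) : ℝ :=
  ∑ s ∈ range t, if keeps m c s then candidateGain g f ω (selected g f ω m c s) (s + 1) else 0

theorem totalGain_mono : Monotone (totalGain g f m c ω) := fun _ _ hab =>
  sum_le_sum_of_subset_of_nonneg (range_mono hab) fun _ _ _ => by
    split_ifs
    · exact candidateGain_nonneg _ _
    · exact le_rfl

theorem apply_selected_le_totalGain (h0 : f ∅ = 0) (t : ℕ) :
    f (selected g f ω m c t) ≤ totalGain g f m c ω t := by
  induction t with
  | zero => simp [selected, totalGain, h0]
  | succ t ih =>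
    have hs : totalGain g f m c ω (t + 1) = totalGain g f m c ω t + _ := sum_range_succ _ _
    rw [hs, selected_succ, candidateGain]
    cases h : candidate g f ω (selected g f ω m c t) (t + 1) with
    | none => simpa using ih
    | some x =>
      cases keeps m c t with
      | false => simpa using ih
      | true =>
        have := marginal_le_gain (f := f) (selected g f ω m c t) x
        rw [marginal_singleton] at this
        simp only [if_true]
        linarith

/-- Keeping only the elements with a positive marginal value collects all of the gains. -/
theorem exists_subset_totalGain_le (hf : IsSubmodular f) (h0 : f ∅ = 0) (t : ℕ) :
    ∃ A ⊆ selected g f ω m c t, totalGain g f m c ω t ≤ f A := by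
  induction t with
  | zero => exact ⟨∅, by simp, by simp [totalGain, h0]⟩
  | succ t ih =>
    obtain ⟨A, hA, hAf⟩ := ih
    have hs : totalGain g f m c ω (t + 1) = totalGain g f m c ω t + _ := sum_range_succ _ _
    rw [hs, selected_succ, candidateGain]
    cases h : candidate g f ω (selected g f ω m c t) (t + 1) with
    | none => exact ⟨A, hA, by simpa using hAf⟩
    | some x =>
      cases keeps m c t with
      | false => exact ⟨A, hA, by simpa using hAf⟩
      | true =>
        simp only [if_true]
        -- The marginal of `x` over the smaller set `A` is at least the one counted in the gain.
        have hm := hf.marginal_anti hA (notMem_of_candidate_eq_some h)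
        rw [marginal_singleton (S := A)] at hm
        rcases le_total (marginal f (selected g f ω m c t) {x}) 0 with hneg | hpos
        · refine ⟨A, hA.trans (subset_insert _ _), ?_⟩
          rw [gain, max_eq_left hneg]
          linarith
        · refine ⟨insert x A, insert_subset_insert _ hA, ?_⟩
          rw [gain, max_eq_right hpos]
          linarith

/-- The share of group `i` in the value that `T` adds to `S`. -/
noncomputable def groupShare (g : Ω → Fin k) (f : Finset Ω → ℝ) (T : Finset Ω) (i : Fin k)
    (S : Finset Ω) : ℝ :=
  ∑ t ∈ T.filter (fun t => g t = i), gain f (S ∪ T.filter (· < t)) t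

variable {T : Finset Ω}

theorem groupShare_nonneg (i : Fin k) (S : Finset Ω) : 0 ≤ groupShare g f T i S :=
  sum_nonneg fun _ _ => gain_nonneg _ _

theorem groupShare_le_empty (hf : IsSubmodular f) (i : Fin k) (S : Finset Ω) :
    groupShare g f T i S ≤ groupShare g f T i ∅ :=
  sum_le_sum fun t _ => hf.gain_anti (union_subset_union_left (empty_subset S)) t

theorem le_sum_groupShare (S : Finset Ω) : f (S ∪ T) - f S ≤ ∑ i, groupShare g f T i S := by
  simp only [groupShare]
  rw [sum_fiberwise, ← sum_marginal_filter_lt]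
  exact sum_le_sum fun t _ => marginal_le_gain _ _

/-- For an optimal set, no share is due to a truncation. -/
theorem sum_groupShare_empty (hf : IsSubmodular f) (h0 : f ∅ = 0) (hT : PartitionIndep g T)
    (hmax : ∀ T', PartitionIndep g T' → f T' ≤ f T) :
    ∑ i, groupShare g f T i ∅ = f T := by
  simp only [groupShare]
  rw [sum_fiberwise]
  have h := sum_marginal_filter_lt f ∅ T
  rw [empty_union, h0, sub_zero] at h
  rw [← h]
  -- Removing `t` from `T` leaves an independent set, so by optimality the last marginal is
  -- nonnegative, and by submodularity so are the earlier ones.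
  refine sum_congr rfl fun t ht => max_eq_right ?_
  rw [empty_union]
  have h1 : T.filter (· < t) ⊆ T.erase t := fun x hx => by
    rw [mem_filter] at hx
    exact mem_erase.2 ⟨hx.2.ne, hx.1⟩
  refine le_trans ?_ (hf.marginal_anti h1 (notMem_erase t T))
  rw [marginal_singleton, insert_erase ht, sub_nonneg]
  exact hmax _ fun i => (card_le_card (filter_subset_filter _ (erase_subset _ _))).trans (hT i)

/-- `T` has at most one element in the group, and its gain over a superset of `S` is at most its
gain over `S`, hence at most that of `e`. -/
theorem groupShare_le_gain (hf : IsSubmodular f) (hT : PartitionIndep g T) {i : Fin k}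
    {S : Finset Ω} {e : Ω} (he : IsHighest f S (groupSet g i) e) :
    groupShare g f T i S ≤ gain f S e := by
  have h1 : ∀ t ∈ T.filter (fun t => g t = i), gain f (S ∪ T.filter (· < t)) t ≤ gain f S e := by
    intro t ht
    refine (hf.gain_anti subset_union_left t).trans (max_le_max le_rfl ?_)
    by_cases hte : t = e
    · rw [hte]
    · exact (he.2 t (mem_groupSet.2 (mem_filter.1 ht).2) hte).marginal_le
  refine (sum_le_card_nsmul _ _ _ h1).trans ?_
  rw [nsmul_eq_mul]
  have h2 : (((T.filter (fun t => g t = i)).card : ℕ) : ℝ) ≤ 1 := by exact_mod_cast hT i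
  exact mul_le_of_le_one_left (gain_nonneg _ _) h2

/-- The good event of a group makes its highest element the candidate, so it happens for at most one
group, and the candidate's gain covers that group's share. -/
theorem sum_groupShare_mul_goodEvent_le (hf : IsSubmodular f) (hT : PartitionIndep g T)
    (S : Finset Ω) (j : ℕ) :
    ∑ i, groupShare g f T i S * ind (GoodEvent g f ω S i j) ≤ candidateGain g f ω S j := by
  have h1 : ∀ i ∈ univ, groupShare g f T i S * ind (GoodEvent g f ω S i j) ≤
      candidateGain g f ω S j * ind (∃ x, g x = i ∧ candidate g f ω S j = some x) := by
    intro i _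
    by_cases h : GoodEvent g f ω S i j
    · obtain ⟨e, he, hc⟩ := h.candidate_eq
      rw [ind_of h, ind_of ⟨e, mem_groupSet.1 he.1, hc⟩, mul_one, mul_one, candidateGain, hc]
      exact groupShare_le_gain hf hT he
    · rw [ind_of_not h, mul_zero]
      exact mul_nonneg (candidateGain_nonneg _ _) (ind_nonneg _)
  refine (sum_le_sum h1).trans ?_
  rw [← mul_sum]
  refine mul_le_of_le_one_right (candidateGain_nonneg _ _) (sum_ind_le_one _ ?_)
  rintro i i' ⟨x, rfl, hx⟩ ⟨x', rfl, hx'⟩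
  rw [hx, Option.some.injEq] at hx'
  rw [hx']

/-- The weighted estimate with `Y` the share of group `i` and `y` its value at `∅`, summed over `i`;
the bounds `y` add up to `f T` because `T` is optimal. -/
theorem le_arrivalMean_candidateGain (hf : IsSubmodular f) (h0 : f ∅ = 0)
    (hT : PartitionIndep g T) (hmax : ∀ T', PartitionIndep g T' → f T' ≤ f T) (j : Fin k) :
    1 / (200 * (k : ℝ)) * (arrivalMean (fun ω => f (selected g f ω m c j ∪ T)) -
        arrivalMean (fun ω => f (selected g f ω m c j)) - 7 / 100 * f T) ≤
      arrivalMean (fun ω => candidateGain g f ω (selected g f ω m c j) (j + 1)) := by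
  have h1 : ∀ i ∈ univ, 1 / (200 * (k : ℝ)) *
      (arrivalMean (fun ω => groupShare g f T i (selected g f ω m c j)) -
        7 / 100 * groupShare g f T i ∅) ≤
      arrivalMean (fun ω => groupShare g f T i (selected g f ω m c j) *
        ind (GoodEvent g f ω (selected g f ω m c j) i (j + 1))) := by
    intro i _
    by_cases hne : (groupSet g i).Nonempty
    · exact le_arrivalMean_mul_goodEvent hne j m c (groupShare g f T i) _
        (groupShare_nonneg i) (groupShare_le_empty hf i)
    · have hz : ∀ S, groupShare g f T i S = 0 := fun S => by
        rw [groupShare, filter_false_of_mem, sum_empty]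
        exact fun t _ ht => hne ⟨t, mem_groupSet.2 ht⟩
      simp [hz, arrivalMean_const]
  have h2 := sum_le_sum h1
  rw [← mul_sum, sum_sub_distrib, ← mul_sum, sum_groupShare_empty hf h0 hT hmax,
    ← arrivalMean_sum, ← arrivalMean_sum] at h2
  refine le_trans ?_ (h2.trans (arrivalMean_mono fun ω =>
    sum_groupShare_mul_goodEvent_le hf hT _ _))
  refine mul_le_mul_of_nonneg_left ?_ (by positivity)
  rw [← arrivalMean_sub]
  exact sub_le_sub_right (arrivalMean_mono fun ω => le_sum_groupShare _) _

/-- Half of `f T` survives when the selected set is added. -/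
theorem le_coinMean_apply_union (hf : IsSubmodular f) (hn : ∀ S, 0 ≤ f S) (T : Finset Ω) (t : ℕ) :
    1 / 2 * f T ≤
      coinMean (fun c => arrivalMean (fun ω => f (selected g f ω m c t ∪ T))) := by
  have h := coinMean_flipOn univ
    (fun c => arrivalMean (fun ω => f (selected g f ω m c t ∪ T)))
  have h2 : f T ≤ coinMean (fun c => arrivalMean (fun ω => f (selected g f ω m c t ∪ T)) +
      arrivalMean (fun ω => f (selected g f ω m (flipOn univ c) t ∪ T))) := by
    rw [← coinMean_const (ι := Fin k) (f T)]
    refine coinMean_mono fun c => ?_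
    rw [← arrivalMean_add, ← arrivalMean_const (Ω := Ω) (k := k) (f T)]
    refine arrivalMean_mono fun ω => ?_
    have h3 := hf (selected g f ω m c t ∪ T) (selected g f ω m (flipOn univ c) t ∪ T)
    rw [← inter_union_distrib_right, selected_inter_selected_flipOn_univ, empty_union] at h3
    have := hn (selected g f ω m c t ∪ T ∪ (selected g f ω m (flipOn univ c) t ∪ T))
    linarith
  rw [coinMean_add, h] at h2
  linarith

theorem apply_le_mul_coinMean_totalGain (hk : 0 < k) (hf : IsSubmodular f) (hn : ∀ S, 0 ≤ f S)
    (h0 : f ∅ = 0) (hT : PartitionIndep g T) (hmax : ∀ T', PartitionIndep g T' → f T' ≤ f T) :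
    f T ≤ 1000 * coinMean (fun c => arrivalMean (fun ω => totalGain g f m c ω k)) := by
  set D := coinMean (fun c => arrivalMean (fun ω => totalGain g f m c ω k))
  have hkpos : (0 : ℝ) < k := by exact_mod_cast hk
  let G : ℕ → (Fin k → Bool) → ℝ := fun j c =>
    arrivalMean (fun ω => candidateGain g f ω (selected g f ω m c j) (j + 1))
  -- The constant is `1/2 - 7/100`, and `D` bounds the expected value of the current set.
  have hG : ∀ j : Fin k, 1 / (200 * (k : ℝ)) * (43 / 100 * f T - D) ≤ coinMean (G j) := by
    intro j
    have h1 := coinMean_mono fun c =>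
      le_arrivalMean_candidateGain (m := m) (c := c) hf h0 hT hmax j
    refine le_trans ?_ h1
    rw [coinMean_const_mul, coinMean_sub, coinMean_sub, coinMean_const]
    refine mul_le_mul_of_nonneg_left ?_ (by positivity)
    have h2 := le_coinMean_apply_union (g := g) (m := m) hf hn T j
    have h3 : coinMean (fun c => arrivalMean (fun ω => f (selected g f ω m c j))) ≤ D :=
      coinMean_mono fun c => arrivalMean_mono fun ω =>
        (apply_selected_le_totalGain h0 _).trans (totalGain_mono j.2.le)
    linarith
  have hD : D = ∑ j : Fin k, 1 / 2 * coinMean (G j) := by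
    have h1 : ∀ j : Fin k, 1 / 2 * coinMean (G j) =
        coinMean (fun c => if keeps m c j then G j c else 0) := fun j =>
      (coinMean_keeps (G j) fun c => by simp only [G, selected_flipOn]).symm
    rw [sum_congr rfl fun j _ => h1 j, ← coinMean_sum]
    simp only [D, totalGain, ← Fin.sum_univ_eq_sum_range (fun s =>
      if keeps m _ s then candidateGain g f _ (selected g f _ m _ s) (s + 1) else 0)]
    congr 1
    ext c
    rw [arrivalMean_sum]
    refine sum_congr rfl fun j _ => ?_
    cases keeps m c j with
    | false => simp [arrivalMean_const]
    | true => simp [G]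
  have hsum := sum_le_sum fun j (_ : j ∈ univ) =>
    mul_le_mul_of_nonneg_left (hG j) (by norm_num : (0 : ℝ) ≤ 1 / 2)
  rw [← hD, sum_const, card_univ, Fintype.card_fin, nsmul_eq_mul] at hsum
  -- Summing over the epochs gives `D ≥ (43/100 * f T - D) / 400`, so `f T ≤ (40100/43) * D`.
  have e : (k : ℝ) * (1 / 2 * (1 / (200 * (k : ℝ)) * (43 / 100 * f T - D))) =
      1 / 400 * (43 / 100 * f T - D) := by field_simp; ring
  rw [e] at hsum
  have := hn T
  linarith

/-- The factor `12` is `3` for the probability of mode `B` times `4` for the random half. -/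
theorem coinMean_totalGain_le_expectation (hf : IsSubmodular f) (hn : ∀ S, 0 ≤ f S)
    (h0 : f ∅ = 0) :
    coinMean (fun c => arrivalMean (fun ω => totalGain g f Mode.B c ω k)) ≤
      12 * expectation (fun o : Outcome Ω k => f (output g f o)) := by
  rw [expectation_eq]
  have hnonneg : ∀ m ∈ univ, 0 ≤ coinMean (fun c => arrivalMean (fun ω =>
      coinMean (fun keep => f (output g f (ω, m, c, keep))))) := by
    intro m _
    rw [← coinMean_const (ι := Fin k) 0]
    refine coinMean_mono fun c => ?_
    rw [← arrivalMean_const (Ω := Ω) (k := k) 0]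
    refine arrivalMean_mono fun ω => ?_
    rw [← coinMean_const (ι := Ω) 0]
    exact coinMean_mono fun keep => hn _
  have h1 := single_le_sum hnonneg (mem_univ Mode.B)
  have h2 : coinMean (fun c => arrivalMean (fun ω => totalGain g f Mode.B c ω k)) ≤
      4 * coinMean (fun c => arrivalMean (fun ω =>
        coinMean (fun keep => f (output g f (ω, Mode.B, c, keep))))) := by
    rw [← coinMean_const_mul]
    refine coinMean_mono fun c => ?_
    rw [← arrivalMean_const_mul]
    refine arrivalMean_mono fun ω => ?_
    obtain ⟨A, hA, hAf⟩ := exists_subset_totalGain_le (g := g) (ω := ω) (m := Mode.B) (c := c)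
      hf h0 k
    exact hAf.trans (hf.le_four_mul_coinMean hn hA)
  linarith

theorem apply_le_mul_expectation (hf : IsSubmodular f) (hn : ∀ S, 0 ≤ f S) (h0 : f ∅ = 0)
    (hT : PartitionIndep g T) :
    f T ≤ 12000 * expectation (fun o : Outcome Ω k => f (output g f o)) := by
  have hB := coinMean_totalGain_le_expectation (g := g) hf hn h0
  rcases Nat.eq_zero_or_pos k with rfl | hk
  · have hT0 : T = ∅ := eq_empty_of_forall_notMem fun x _ => (g x).elim0
    simp only [totalGain, range_zero, sum_empty, arrivalMean_const, coinMean_const] at hB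
    rw [hT0, h0]
    linarith
  · classical
    -- The share argument needs an optimal independent set, so `T` is replaced by one.
    obtain ⟨T', hT', hmax⟩ := exists_max_image (univ.filter fun T : Finset Ω => PartitionIndep g T)
      f ⟨T, by simpa using hT⟩
    simp only [mem_filter, mem_univ, true_and] at hT' hmax
    have h1 := hmax T hT
    have h2 := apply_le_mul_coinMean_totalGain (m := Mode.B) hk hf hn h0 hT' hmax
    linarith

end Value

end SubmodularSecretary

theorem mainTheorem9 :
    (∀ (k : ℕ) (Ω : Type u) [Fintype Ω] [LinearOrder Ω] (g : Ω → Fin k) (f : Finset Ω → ℝ),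
      IsSubmodular f → (∀ S, 0 ≤ f S) → f ∅ = 0 →
      -- epoch `j + 1` uses the valuation function `f_{S_j}`, for `j = 0, …, k - 1`
      ∀ i j : Fin k, (groupSet g i).Nonempty →
        (∀ (m : Mode) (c : Fin k → Bool),
          37 / (16000 * (k : ℝ)) ≤
            arrivalProb (fun ω => GoodEvent g f ω (selected g f ω m c j) i (j + 1))) ∧
        (∀ (m : Mode) (c : Fin k → Bool),
          37 / (16000 * (k : ℝ)) ≤
            arrivalProb (fun ω => ∃ e,
              IsHighest f (selected g f ω m c j) (groupSet g i) e ∧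
                candidate g f ω (selected g f ω m c j) (j + 1) = some e)) ∧
        37 / (32000 * (k : ℝ)) ≤
          prob (fun o : Outcome Ω k => ∃ e,
            IsHighest f (selected g f o.1 o.2.1 o.2.2.1 j) (groupSet g i) e ∧
              e ∉ selected g f o.1 o.2.1 o.2.2.1 j ∧
              e ∈ selected g f o.1 o.2.1 o.2.2.1 (j + 1))) ∧
    ∃ C : ℝ, 0 < C ∧
      ∀ (k : ℕ) (Ω : Type u) [Fintype Ω] [LinearOrder Ω] (g : Ω → Fin k) (f : Finset Ω → ℝ),
        IsSubmodular f → (∀ S, 0 ≤ f S) → f ∅ = 0 →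
        (∀ o : Outcome Ω k, PartitionIndep g (output g f o)) ∧
        ∀ T : Finset Ω, PartitionIndep g T →
          f T ≤ C * expectation (fun o => f (output g f o)) := by
  refine ⟨?_, 12000, by norm_num, ?_⟩
  · intro k Ω _ _ g f _ _ _ i j hne
    exact ⟨fun m c => le_arrivalProb_goodEvent hne j m c,
      fun m c => le_arrivalProb_candidate hne j m c, le_prob_selected hne j⟩
  · intro k Ω _ _ g f hf hn h0
    exact ⟨partitionIndep_output, fun T hT => apply_le_mul_expectation hf hn h0 hT⟩
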